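/- Let $q\ge 2$ be an integer, let $\mathfrak X$ be the vertex set of the $(q+1)$-homogeneous tree with graph distance $d$, fix $o\in\mathfrak X$, and let $\tau=\pi/\log q$. Let $\Omega$ be the boundary of the tree, that is, the set of equivalence classes of half geodesics under eventual equality up to a shift; $[x,\omega)$ denotes the half geodesic from $x$ in the class $\omega$. Let $\Omega(x,y)$ be the set of $\omega$ such that $[x,\omega)$ passes through $y$; these cylinders generate the topology of $\Omega$. Let $\Omega_n(x,\omega)=\Omega(x,x_n)$, where $x_n$ is the $n$-th vertex of $[x,\omega)$. Let $\nu_x$ be the Borel probability measure on $\Omega$ with $\nu_x(\Omega(x,y))=\frac1{(q+1)q^{n-1}}$ if $d(x,y)=n\ge1$. Let $h_\omega(x)=\lim_m (m-d(x,x_m))$, where $[o,\omega)=(x_0,x_1,\dots)$. Let $$d\mu(s)=\frac{q\log q}{4\pi(q+1)}\,|\mathbf c(s)|^{-2}\,ds,\qquad \mathbf c(z)=\frac{q^{1/2}}{q+1}\,\frac{q^{1/2+iz}-q^{-1/2-iz}}{q^{iz}-q^{-iz}},$$ and $\mathcal E^x_n\eta(\omega)=\frac1{\nu_x(\Omega_n(x,\omega))}\int_{\Omega_n(x,\omega)}\eta\,d\nu_x$.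 Let $S(\mathfrak X\times\mathfrak X)$ be the set of functions $a:\mathfrak X\times\mathfrak X\times\Omega\times[0,\tau]\to\mathbb C$ such that all derivatives $\partial_s^k a$, $k\ge0$, exist and are continuous, $\partial_s^k a(x,y,\omega,0)=\partial_s^k a(x,y,\omega,\tau)=0$ for all $k,x,y,\omega$, and for every $l\in\mathbb N$ there is $C_l$ with $\|(a-\mathcal E^x_na)(x,y,\cdot,\cdot)\|_\infty\le C_l(1+n)^{-l}$ for all $x,y\in\mathfrak X$, $n\in\mathbb N$. For $a\in S(\mathfrak X\times\mathfrak X)$ and $u$ finitely supported let $$\mathrm{OP}(a)u(x)=\sum_{y}\int_\Omega\int_0^\tau q^{(\frac12+is)(h_\omega(y)-h_\omega(x))}a(x,y,\omega,s)\,u(y)\,d\mu(s)\,d\nu_x(\omega).$$ Then for every $N\in\mathbb N$ there is a constant $C_N>0$, depending only on $N$ and $q$, such that for every $a\in S(\mathfrak X\times\mathfrak X)$ the following hold. The operator $\mathrm{OP}(a)$ has the kernel $$K_a(x,y)=\int_\Omega\int_0^\tau q^{(\frac12+is)(h_\omega(y)-h_\omega(x))}a(x,y,\omega,s)\,d\mu(s)\,d\nu_x(\omega),$$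 that is, $\mathrm{OP}(a)u(x)=\sum_y K_a(x,y)u(y)$ for finitely supported $u$, and for all $x,y\in\mathfrak X$ $$|K_a(x,y)|\le C_a(N)\,\frac{q^{-d(x,y)/2}}{(1+d(x,y))^{N}},\qquad C_a(N)=C_N\Big(\|a\|_{\Omega,N+1}+\sum_{k=0}^{N+1}\|\partial_s^ka\|_\infty\Big),$$ where $\|a\|_{\Omega,l}=\sup_{x,y\in\mathfrak X}\sup_{n\in\mathbb N}(n+1)^{l}\|(a-\mathcal E^x_na)(x,y,\cdot,\cdot)\|_\infty$ and $\|\partial_s^ka\|_\infty$ is the supremum over $\mathfrak X\times\mathfrak X\times\Omega\times[0,\tau]$, both taken in $[0,\infty]$. If $\partial_s^ka$ is bounded for every $k\le N+1$, then $C_a(N)<\infty$. -/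

import Mathlib

open MeasureTheory Set Filter Topology
open scoped ENNReal

universe u

noncomputable section

namespace HomTree

/-! ### Half geodesics and the boundary of a tree -/

/-- A half geodesic `(r 0, r 1, r 2, …)` in a graph: any two of its vertices are at the graph
distance given by the difference of their indices. -/
structure GeodesicRay {V : Type u} (G : SimpleGraph V) where
  vertex : ℕ → V
  geodesic : ∀ i j, G.dist (vertex i) (vertex (i + j)) = j

/-- Two half geodesics are equivalent if they meet at infinity, i.e. if they agree eventually up
to a shift of the indices. -/
def rayEquiv {V : Type u} (G : SimpleGraph V) : Setoid (GeodesicRay G) where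
  r r₁ r₂ := ∃ k l : ℕ, ∀ m, r₁.vertex (m + k) = r₂.vertex (m + l)
  iseqv :=
    { refl := fun _ => ⟨0, 0, fun _ => rfl⟩
      symm := fun ⟨k, l, h⟩ => ⟨l, k, fun m => (h m).symm⟩
      trans := by
        rintro r₁ r₂ r₃ ⟨k, l, h⟩ ⟨k', l', h'⟩
        refine ⟨k + k', l + l', fun m => ?_⟩
        have e₁ := h (m + k')
        have e₂ := h' (m + l)
        rw [show m + (k + k') = m + k' + k by ring, e₁,
          show m + k' + l = m + l + k' by ring, e₂]
        congr 1
        ring }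

/-- The boundary `Ω`: the set of equivalence classes of half geodesics. -/
def Boundary {V : Type u} (G : SimpleGraph V) : Type u := Quotient (rayEquiv G)

/-- The boundary point defined by a half geodesic. -/
def endpoint {V : Type u} {G : SimpleGraph V} (r : GeodesicRay G) : Boundary G :=
  Quotient.mk (rayEquiv G) r

/-- The cylinder `Ω(x, y)`: the boundary points `ω` such that the half geodesic `[x, ω)` starting
at `x` and equivalent to `ω` passes through `y`. -/
def cylinder {V : Type u} (G : SimpleGraph V) (x y : V) : Set (Boundary G) :=
  {ω | ∃ r : GeodesicRay G, r.vertex 0 = x ∧ endpoint r = ω ∧ ∃ n, r.vertex n = y}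

/-- The set `Ω_n(x, ω) = Ω(x, x_n)`, where `x_n` is the vertex of `[x, ω)` at distance `n` from
`x`. -/
def cylinderAt {V : Type u} (G : SimpleGraph V) (x : V) (n : ℕ) (ω : Boundary G) :
    Set (Boundary G) :=
  {ω' | ∃ y, G.dist x y = n ∧ ω ∈ cylinder G x y ∧ ω' ∈ cylinder G x y}

/-- The topology of the boundary is generated by the cylinders. -/
instance {V : Type u} (G : SimpleGraph V) : TopologicalSpace (Boundary G) :=
  TopologicalSpace.generateFrom {s | ∃ x y, s = cylinder G x y}

instance {V : Type u} (G : SimpleGraph V) : MeasurableSpace (Boundary G) := borel _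

instance {V : Type u} (G : SimpleGraph V) : BorelSpace (Boundary G) := ⟨rfl⟩

/-! ### The harmonic measures of the boundary -/

/-- The neighbours of `v` that are farther from `x` than `v` is. -/
@[ext]
structure Next {V : Type u} (G : SimpleGraph V) (x v : V) where
  vertex : V
  adj : G.Adj v vertex
  dist_eq : G.dist x vertex = G.dist x v + 1

instance {V : Type u} (G : SimpleGraph V) (x v : V) : MeasurableSpace (Next G x v) := ⊤

/-- The path starting at `x` that follows the choices `ξ`. -/
def followVertex {V : Type u} (G : SimpleGraph V) (x : V) (ξ : ∀ v, Next G x v) : ℕ → V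
  | 0 => x
  | n + 1 => (ξ (followVertex G x ξ n)).vertex

theorem followVertex_dist {V : Type u} (G : SimpleGraph V) (x : V) (ξ : ∀ v, Next G x v) (n : ℕ) :
    G.dist x (followVertex G x ξ n) = n := by
  induction n with
  | zero => simp [followVertex]
  | succ n ih => rw [followVertex, (ξ (followVertex G x ξ n)).dist_eq, ih]

theorem followVertex_walk {V : Type u} (G : SimpleGraph V) (x : V) (ξ : ∀ v, Next G x v)
    (i j : ℕ) :
    ∃ p : G.Walk (followVertex G x ξ i) (followVertex G x ξ (i + j)), p.length = j := by
  induction j with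
  | zero => exact ⟨SimpleGraph.Walk.nil, rfl⟩
  | succ j ih =>
    obtain ⟨p, hp⟩ := ih
    exact ⟨p.concat (ξ (followVertex G x ξ (i + j))).adj, 
      (SimpleGraph.Walk.length_concat _ _).trans (congrArg (· + 1) hp)⟩

/-- The half geodesic starting at `x` that follows the choices `ξ`. -/
def follow {V : Type u} (G : SimpleGraph V) (x : V) (ξ : ∀ v, Next G x v) : GeodesicRay G where
  vertex := followVertex G x ξ
  geodesic := by
    intro i j
    obtain ⟨p, hp⟩ := followVertex_walk G x ξ i j
    have h₁ := SimpleGraph.dist_le p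
    have h₂ := SimpleGraph.Reachable.dist_triangle_right p.reachable x
    have h₃ := followVertex_dist G x ξ i
    have h₄ := followVertex_dist G x ξ (i + j)
    omega

/-- The probability measure `ν_x` on the boundary: the law of the endpoint of the random half
geodesic that starts at `x` and leaves every vertex `v` through a neighbour chosen uniformly,
independently of the other vertices, among the neighbours of `v` farther from `x`. In the
`(q+1)`-homogeneous tree there are `q + 1` of them if `v = x` and `q` otherwise, so that `ν_x` is
the measure with `ν_x (Ω(x, y)) = 1 / ((q + 1) q ^ (n - 1))` when `d(x, y) = n ≥ 1`. -/
def boundaryMeasure {V : Type u} (G : SimpleGraph V) (x : V) : Measure (Boundary G) :=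
  (Measure.infinitePi fun v => ProbabilityTheory.uniformOn (univ : Set (Next G x v))).map
    fun ξ => endpoint (follow G x ξ)

/-- The averaging operator `𝓔_n^x`: the mean of `η` over `Ω_n(x, ω)` with respect to `ν_x`. -/
def averaging {V : Type u} (G : SimpleGraph V) (x : V) (n : ℕ) (η : Boundary G → ℂ)
    (ω : Boundary G) : ℂ :=
  ⨍ ω' in cylinderAt G x n ω, η ω' ∂(boundaryMeasure G x)

/-- The height function `h_ω(x) = lim_m (d(o, r m) - d(x, r m))`, for a half geodesic `r`
representing `ω`. The terms of the sequence are eventually constant in a tree, and do not depend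
eventually on the representative; for `r = [o, ω)` they are `m - d(x, r m)`. -/
def height {V : Type u} (G : SimpleGraph V) (o : V) (ω : Boundary G) (x : V) : ℤ :=
  limUnder atTop fun m : ℕ =>
    (G.dist o ((Quotient.out ω).vertex m) : ℤ) - (G.dist x ((Quotient.out ω).vertex m) : ℤ)

/-! ### The Plancherel measure -/

/-- `τ = π / log q`. -/
def period (q : ℕ) : ℝ := Real.pi / Real.log q

/-- The function `c(z) = q^(1/2)/(q+1) * (q^(1/2+iz) - q^(-1/2-iz)) / (q^(iz) - q^(-iz))`. -/
def cFunction (q : ℕ) (z : ℂ) : ℂ :=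
  (q : ℂ) ^ (1 / 2 : ℂ) / (q + 1) *
    (((q : ℂ) ^ (1 / 2 + Complex.I * z) - (q : ℂ) ^ (-1 / 2 - Complex.I * z)) /
      ((q : ℂ) ^ (Complex.I * z) - (q : ℂ) ^ (-(Complex.I * z))))

/-- The density `c_P |c(s)|^(-2)` of the Plancherel measure `dμ(s)` with respect to `ds`, where
`c_P = q log q / (4 π (q + 1))`. -/
def plancherelDensity (q : ℕ) (s : ℝ) : ℝ :=
  q * Real.log q / (4 * Real.pi * (q + 1)) * (‖cFunction q s‖ ^ 2)⁻¹

/-! ### Double symbols, their operators and kernels -/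

/-- Functions `a(x, y, ω, s)` on `𝔛 × 𝔛 × Ω × [0, τ]`. They are given as functions of a real
variable `s`; only their values for `s ∈ [0, τ]` enter the notions below. -/
abbrev DoubleFunction {V : Type u} (G : SimpleGraph V) : Type u :=
  V → V → Boundary G → ℝ → ℂ

/-- The derivative `∂_s^k a (x, y, ω, s)` on `[0, τ]`, one-sided at the end points. -/
def sDeriv {V : Type u} {G : SimpleGraph V} (q k : ℕ) (a : DoubleFunction G) : DoubleFunction G :=
  fun x y ω s => iteratedDerivWithin k (a x y ω) (Icc 0 (period q)) s

/-- The function `(a - 𝓔_n^x a)(x, y, ω, s)`. -/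
def deviation {V : Type u} {G : SimpleGraph V} (n : ℕ) (a : DoubleFunction G) :
    DoubleFunction G :=
  fun x y ω s => a x y ω s - averaging G x n (fun ω' => a x y ω' s) ω

/-- The class `S(𝔛 × 𝔛)` of double symbols (the vertex set is discrete, so that continuity on
`𝔛 × 𝔛 × Ω × [0, τ]` is continuity on `Ω × [0, τ]` for all `x, y`). -/
structure IsDoubleSymbol {V : Type u} {G : SimpleGraph V} (q : ℕ) (a : DoubleFunction G) :
    Prop where
  smooth : ∀ x y ω, ContDiffOn ℝ (⊤ : ℕ∞) (a x y ω) (Icc 0 (period q))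
  continuous : ∀ (k : ℕ) (x y : V),
    ContinuousOn (fun p : Boundary G × ℝ => sDeriv q k a x y p.1 p.2) (univ ×ˢ Icc 0 (period q))
  regular : ∀ l : ℕ, ∃ C : ℝ, ∀ (n : ℕ) (x y : V) (ω : Boundary G), ∀ s ∈ Icc 0 (period q),
    ‖deviation n a x y ω s‖ ≤ C / (1 + (n : ℝ)) ^ l
  vanish : ∀ (k : ℕ) (x y : V) (ω : Boundary G),
    sDeriv q k a x y ω 0 = 0 ∧ sDeriv q k a x y ω (period q) = 0

/-- The number `∫_Ω ∫_0^τ q^((1/2 + is)(h_ω(y) - h_ω(x))) f(ω, s) dν_x(ω) dμ(s)`. -/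
def fourierIntegral {V : Type u} (G : SimpleGraph V) (q : ℕ) (o x y : V)
    (f : Boundary G → ℝ → ℂ) : ℂ :=
  ∫ ω, (∫ s in (0 : ℝ)..period q,
    (q : ℂ) ^ ((1 / 2 + Complex.I * (s : ℂ)) * ((height G o ω y - height G o ω x : ℤ) : ℂ)) *
      f ω s * (plancherelDensity q s : ℂ)) ∂(boundaryMeasure G x)

/-- The operator `OP(a)` on finitely supported functions. -/
def OP {V : Type u} {G : SimpleGraph V} (q : ℕ) (o : V) (a : DoubleFunction G) (u : V →₀ ℂ)
    (x : V) : ℂ :=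
  ∑ y ∈ u.support, fourierIntegral G q o x y fun ω s => a x y ω s * u y

/-- The kernel `K_a(x, y)`. -/
def kernel {V : Type u} {G : SimpleGraph V} (q : ℕ) (o : V) (a : DoubleFunction G) (x y : V) : ℂ :=
  fourierIntegral G q o x y (a x y)

/-- The uniform norm of a function on `Ω × [0, τ]`, in `[0, ∞]`. -/
def supNorm {V : Type u} {G : SimpleGraph V} (q : ℕ) (f : Boundary G → ℝ → ℂ) : ℝ≥0∞ :=
  ⨆ (ω : Boundary G) (s : ℝ) (_ : s ∈ Icc 0 (period q)), ‖f ω s‖ₑ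

/-- `‖a‖_∞`, the uniform norm on `𝔛 × 𝔛 × Ω × [0, τ]`, in `[0, ∞]`. -/
def fullSupNorm {V : Type u} {G : SimpleGraph V} (q : ℕ) (a : DoubleFunction G) : ℝ≥0∞ :=
  ⨆ (x : V) (y : V), supNorm q (a x y)

/-- `‖a‖_{Ω, l} = sup_{x, y} sup_n (n + 1)^l ‖(a - 𝓔_n^x a)(x, y, ·, ·)‖_∞`, in `[0, ∞]`. -/
def omegaNorm {V : Type u} {G : SimpleGraph V} (q l : ℕ) (a : DoubleFunction G) : ℝ≥0∞ :=
  ⨆ (x : V) (y : V) (n : ℕ), ((n : ℝ≥0∞) + 1) ^ l * supNorm q (deviation n a x y)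

end HomTree

end

/-!
Write `d = d(x, y)`, let `v 0 = x, …, v d = y` be the geodesic from `x` to `y`, and put
`w = q^{2is}`. If the half geodesic `[x, ω)` follows this geodesic up to `v j`, then
`h_ω(y) - h_ω(x) = 2 j - d`, so that the factor `q^{(1/2 + is)(h_ω(y) - h_ω(x))}` in the kernel is
`q^{-d/2} q^{-ids} (q w)^j` (`exists_confluence`). Since `ω ∈ Ω(x, v i)` if and only if `i ≤ j`, the
identity `(q w)^j = 1 + ∑_{i < j} (q w)^i (q w - 1)` writes the kernel as `q^{-d/2}` times
the sum of an integral over `Ω` with the frequency `-d` and, for every `i < d`, an integral over the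
cylinder `Ω(x, v (i + 1))` with the frequency `2 i - d` (`fourierIntegral_eq`). The
weight `q^i` is compensated by `ν_x(Ω(x, v (i + 1))) = 1 / ((q + 1) q^i)` (`boundaryMeasure_cylinder`).

It remains to gain a factor `(1 + d)^{-N}` (`exists_norm_sum_waveIntegral_le`). For `i < d / 4`, as
for the integral over `Ω`, the frequency is comparable to `d`, and `N + 1` integrations by
parts in `s` give `(1 + d)^{-(N + 1)}` for each term (`exists_norm_integral_wave_le`). For `i ≥ n = d / 4` the
symbol is replaced by its mean over `Ω(x, v n)`, at the cost of `‖a‖_{Ω, N + 1} (1 + n)^{-(N + 1)}`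
for each term. After this replacement the terms with `i ≥ n` form a geometric sum in `w`. The
Plancherel density is `c₀ (1 - w) (1 - w⁻¹) / ((q w - 1) (q w⁻¹ - 1))`: its factor `1 - w` cancels
the denominator of the geometric sum, and its denominator cancels the factor `q w - 1`. So only
the two boundary terms remain; their frequencies `2 n - d` and `d` are comparable to `d`, and
integration by parts applies to them.

The facts about trees are reduced to graph distances: `ω ∈ Ω(x, y)` if and only if `y` is
eventually on the geodesic from `x` to the vertices of a half geodesic representing `ω`
(`endpoint_mem_cylinder_iff`). In particular, this makes the law `ν_x` of the endpoint of the random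
path a genuine image measure (`measurable_endpoint_follow`).
-/

namespace HomTree

/-! ### Geodesics and half geodesics in a tree -/

section Tree

variable {V : Type u} {G : SimpleGraph V}

/-- A geodesic from `x` to `y`, as a sequence of vertices of which only the first `d(x, y) + 1`
matter. -/
theorem exists_geodesic (hG : G.Connected) (x y : V) :
    ∃ v : ℕ → V, v 0 = x ∧ v (G.dist x y) = y ∧
      (∀ i ≤ G.dist x y, G.dist x (v i) = i ∧ i + G.dist (v i) y = G.dist x y) ∧
      ∀ i < G.dist x y, G.Adj (v i) (v (i + 1)) := by
  obtain ⟨p, hp⟩ := hG.exists_walk_length_eq_dist x y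
  refine ⟨p.getVert, p.getVert_zero, by rw [← hp, p.getVert_length], fun i hi => ?_,
    fun i hi => p.adj_getVert_succ (hp ▸ hi)⟩
  have h₁ := SimpleGraph.dist_le (p.take i)
  have h₂ := SimpleGraph.dist_le (p.drop i)
  rw [SimpleGraph.Walk.take_length] at h₁
  rw [SimpleGraph.Walk.drop_length] at h₂
  have h₃ := hG.dist_triangle (u := x) (v := p.getVert i) (w := y)
  omega

/-- In a tree, a vertex of the geodesic from `x` to `z` is determined by its distance to `x`. -/
theorem eq_of_mem_geodesic (hG : G.IsTree) {x y y' z : V}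
    (h : G.dist x z = G.dist x y + G.dist y z) (h' : G.dist x z = G.dist x y' + G.dist y' z)
    (e : G.dist x y = G.dist x y') : y = y' := by
  have key : ∀ y, G.dist x z = G.dist x y + G.dist y z →
      ∃ p : G.Walk x z, p.IsPath ∧ p.getVert (G.dist x y) = y := by
    intro y h
    obtain ⟨p, hp⟩ := hG.connected.exists_walk_length_eq_dist x y
    obtain ⟨p', hp'⟩ := hG.connected.exists_walk_length_eq_dist y z
    refine ⟨p.append p', SimpleGraph.Walk.isPath_of_length_eq_dist _ ?_, ?_⟩
    · rw [SimpleGraph.Walk.length_append, hp, hp', h]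
    · rw [SimpleGraph.Walk.getVert_append, ← hp]
      simp
  obtain ⟨p, hp, hy⟩ := key y h
  obtain ⟨p', hp', hy'⟩ := key y' h'
  rw [← hy, ← hy', e, (hG.existsUnique_path x z).unique hp hp']

/-- In a tree, a path that moves away from `u` and does not turn back keeps moving away. -/
theorem dist_succ_of_ne (hG : G.IsTree) (u : V) {a b c : V} (hab : G.Adj a b) (hbc : G.Adj b c)
    (hac : a ≠ c) (h : G.dist u b = G.dist u a + 1) : G.dist u c = G.dist u b + 1 := by
  rcases hG.dist_eq_dist_add_one_of_adj u hbc with h' | h'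
  · refine absurd (eq_of_mem_geodesic hG (x := b) (z := u) ?_ ?_ ?_) hac
    · rw [SimpleGraph.dist_eq_one_iff_adj.2 hab.symm, G.dist_comm, h, G.dist_comm, add_comm]
    · rw [SimpleGraph.dist_eq_one_iff_adj.2 hbc, G.dist_comm, h', G.dist_comm, add_comm]
    · rw [SimpleGraph.dist_eq_one_iff_adj.2 hab.symm, SimpleGraph.dist_eq_one_iff_adj.2 hbc]
  · exact h'

theorem GeodesicRay.adj (r : GeodesicRay G) (i : ℕ) : G.Adj (r.vertex i) (r.vertex (i + 1)) :=
  SimpleGraph.dist_eq_one_iff_adj.1 (r.geodesic i 1)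

theorem GeodesicRay.ne (r : GeodesicRay G) (i : ℕ) : r.vertex i ≠ r.vertex (i + 2) := by
  intro h
  have := r.geodesic i 2
  rw [← h, SimpleGraph.dist_self] at this
  omega

/-- A half geodesic eventually moves straight away from every vertex `u`. -/
theorem exists_dist_vertex_add (hG : G.IsTree) (r : GeodesicRay G) (u : V) :
    ∃ M, ∀ k ≥ M, ∀ m, G.dist u (r.vertex (k + m)) = G.dist u (r.vertex k) + m := by
  have step : ∃ M, G.dist u (r.vertex (M + 1)) = G.dist u (r.vertex M) + 1 := by
    -- Otherwise the distance to `u` would decrease forever.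
    by_contra! hne
    have : ∀ m, G.dist u (r.vertex m) + m = G.dist u (r.vertex 0) := by
      intro m
      induction m with
      | zero => rfl
      | succ m ih =>
        have := hG.dist_eq_dist_add_one_of_adj u (r.adj m)
        have := hne m
        omega
    have := this (G.dist u (r.vertex 0) + 1)
    omega
  obtain ⟨M, hM⟩ := step
  have h : ∀ m, G.dist u (r.vertex (M + m + 1)) = G.dist u (r.vertex (M + m)) + 1 := by
    intro m
    induction m with
    | zero => exact hM
    | succ m ih => exact dist_succ_of_ne hG u (r.adj _) (r.adj _) (r.ne _) ih
  refine ⟨M, fun k hk m => ?_⟩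
  obtain ⟨j, rfl⟩ := Nat.exists_eq_add_of_le hk
  induction m with
  | zero => rfl
  | succ m ih =>
    have := h (j + m)
    rw [← add_assoc M] at this
    rw [← add_assoc, this, ih, add_assoc]

/-- A path whose `n`-th vertex is at distance `n` from its origin `x`, as a half geodesic. -/
def rayOfDist (x : V) (v : ℕ → V) (hadj : ∀ i, G.Adj (v i) (v (i + 1)))
    (hdist : ∀ i, G.dist x (v i) = i) : GeodesicRay G where
  vertex := v
  geodesic := by
    intro i j
    have hw : ∃ p : G.Walk (v i) (v (i + j)), p.length = j := by
      induction j with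
      | zero => exact ⟨SimpleGraph.Walk.nil, rfl⟩
      | succ j ih =>
        obtain ⟨p, hp⟩ := ih
        exact ⟨p.concat (hadj _),
          (SimpleGraph.Walk.length_concat _ _).trans (congrArg (· + 1) hp)⟩
    obtain ⟨p, hp⟩ := hw
    have h₁ := SimpleGraph.dist_le p
    have h₂ := SimpleGraph.Reachable.dist_triangle_right p.reachable x
    have h₃ := hdist i
    have h₄ := hdist (i + j)
    omega

/-- A boundary point lies in `Ω(x, y)` if and only if `y` is eventually on the geodesic from `x`
to the vertices of a half geodesic representing it. This turns statements about cylinders into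
statements about distances. -/
theorem endpoint_mem_cylinder_iff (hG : G.IsTree) (r : GeodesicRay G) (x y : V) :
    endpoint r ∈ cylinder G x y ↔
      ∀ᶠ m in atTop, G.dist x (r.vertex m) = G.dist x y + G.dist y (r.vertex m) := by
  constructor
  · rintro ⟨r', rfl, hr, n, rfl⟩
    obtain ⟨k, l, h⟩ := Quotient.exact hr
    filter_upwards [eventually_ge_atTop (l + n)] with m hm
    obtain ⟨m, rfl⟩ := Nat.exists_eq_add_of_le hm
    have e : r.vertex (l + n + m) = r'.vertex (n + (m + k)) := by
      rw [show l + n + m = n + m + l by ring, ← h, add_assoc]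
    have h₁ := r'.geodesic 0 (n + (m + k))
    have h₂ := r'.geodesic 0 n
    rw [zero_add] at h₁ h₂
    rw [e, h₁, h₂, r'.geodesic]
  · intro h
    obtain ⟨M₁, hM₁⟩ := eventually_atTop.1 h
    obtain ⟨M₂, hM₂⟩ := exists_dist_vertex_add hG r x
    set M := max M₁ M₂
    set z := r.vertex M with hz
    set D := G.dist x z with hD
    have hxz : D = G.dist x y + G.dist y z := hM₁ M (le_max_left _ _)
    have hz' : ∀ m, G.dist x (r.vertex (M + m)) = D + m := hM₂ M (le_max_right _ _)
    obtain ⟨p, hp⟩ := hG.connected.exists_walk_length_eq_dist x y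
    obtain ⟨p', hp'⟩ := hG.connected.exists_walk_length_eq_dist y z
    -- Follow the geodesic from `x` through `y` to `z`, and then the half geodesic.
    set P := p.append p' with hP
    have hPl : P.length = D := by rw [hP, SimpleGraph.Walk.length_append, hp, hp', hxz]
    let v : ℕ → V := fun i => if i ≤ D then P.getVert i else r.vertex (M + (i - D))
    have hv : ∀ m, v (D + m) = r.vertex (M + m) := by
      intro m
      rcases Nat.eq_zero_or_pos m with rfl | hm
      · simp only [v, add_zero, le_refl, if_true]
        rw [← hPl, P.getVert_length]
      · simp only [v]
        rw [if_neg (by omega), Nat.add_sub_cancel_left]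
    have hv' : ∀ i ≤ D, v i = P.getVert i := fun i hi => if_pos hi
    have hdist : ∀ i, G.dist x (v i) = i := by
      intro i
      rcases le_total i D with hi | hi
      · have h₁ := SimpleGraph.dist_le (P.take i)
        have h₂ := SimpleGraph.dist_le (P.drop i)
        have h₃ := hG.connected.dist_triangle (u := x) (v := P.getVert i) (w := z)
        rw [SimpleGraph.Walk.take_length] at h₁
        rw [SimpleGraph.Walk.drop_length] at h₂
        rw [hv' i hi]
        omega
      · obtain ⟨m, rfl⟩ := Nat.exists_eq_add_of_le hi
        rw [hv, hz']
    have hadj : ∀ i, G.Adj (v i) (v (i + 1)) := by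
      intro i
      rcases lt_or_ge i D with hi | hi
      · rw [hv' i hi.le, hv' (i + 1) hi]
        exact P.adj_getVert_succ (hPl ▸ hi)
      · obtain ⟨m, rfl⟩ := Nat.exists_eq_add_of_le hi
        rw [hv, add_assoc, hv]
        exact r.adj _
    refine ⟨rayOfDist x v hadj hdist, ?_, Quotient.sound ⟨D, M, fun m => ?_⟩, G.dist x y, ?_⟩
    · exact (hv' 0 (Nat.zero_le _)).trans P.getVert_zero
    · change v (m + D) = r.vertex (m + M)
      rw [add_comm m, add_comm m, hv]
    · change v (G.dist x y) = y
      rw [hv' _ (by omega), hP, SimpleGraph.Walk.getVert_append, ← hp]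
      simp

/-- The cylinders `Ω(x, y)` with `d(x, y) = n` are disjoint. -/
theorem eq_of_mem_cylinder (hG : G.IsTree) {x y y' : V} {ω : Boundary G}
    (h : ω ∈ cylinder G x y) (h' : ω ∈ cylinder G x y') (e : G.dist x y = G.dist x y') :
    y = y' := by
  induction ω using Quotient.ind with
  | _ r =>
    obtain ⟨m, h₁, h₂⟩ := (((endpoint_mem_cylinder_iff hG r x y).1 h).and
      ((endpoint_mem_cylinder_iff hG r x y').1 h')).exists
    exact eq_of_mem_geodesic hG h₁ h₂ e

theorem cylinderAt_eq (hG : G.IsTree) {x y : V} {ω : Boundary G} (h : ω ∈ cylinder G x y) :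
    cylinderAt G x (G.dist x y) ω = cylinder G x y := by
  ext ω'
  constructor
  · rintro ⟨y', e, h₁, h₂⟩
    rwa [eq_of_mem_cylinder hG h h₁ e.symm]
  · exact fun h' => ⟨y, rfl, h, h'⟩

/-- The height is a limit of eventually constant integers, so that the difference of two heights
is read off from a distant vertex of a half geodesic. -/
theorem eventually_height_sub_height (hG : G.IsTree) (o x y : V) (r : GeodesicRay G)
    (hr : r = Quotient.out (endpoint r)) :
    ∀ᶠ m in atTop, height G o (endpoint r) y - height G o (endpoint r) x =
      (G.dist x (r.vertex m) : ℤ) - G.dist y (r.vertex m) := by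
  have key : ∀ z, ∀ᶠ m in atTop, height G o (endpoint r) z =
      (G.dist o (r.vertex m) : ℤ) - G.dist z (r.vertex m) := by
    intro z
    obtain ⟨M₁, h₁⟩ := exists_dist_vertex_add hG r o
    obtain ⟨M₂, h₂⟩ := exists_dist_vertex_add hG r z
    set M := max M₁ M₂
    have hc : ∀ m ≥ M, (G.dist o (r.vertex m) : ℤ) - G.dist z (r.vertex m) =
        (G.dist o (r.vertex M) : ℤ) - G.dist z (r.vertex M) := by
      intro m hm
      obtain ⟨m, rfl⟩ := Nat.exists_eq_add_of_le hm
      rw [h₁ M (le_max_left _ _), h₂ M (le_max_right _ _)]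
      push_cast
      ring
    filter_upwards [eventually_ge_atTop M] with m hm
    rw [hc m hm]
    refine Tendsto.limUnder_eq (tendsto_const_nhds.congr' ?_)
    filter_upwards [eventually_ge_atTop M] with m hm
    rw [← hr, hc m hm]
  filter_upwards [key x, key y] with m hx hy
  rw [hx, hy]
  ring

/-- Let `v` be the geodesic from `x` to `y`. The half geodesic `[x, ω)` follows it up to a vertex
`v j`, and then `h_ω(y) - h_ω(x) = 2 j - d(x, y)`. -/
theorem exists_confluence (hG : G.IsTree) (o : V) {x y : V} {v : ℕ → V} (hv0 : v 0 = x)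
    (hvd : v (G.dist x y) = y) (hv : ∀ i ≤ G.dist x y, G.dist x (v i) = i)
    (hadj : ∀ i < G.dist x y, G.Adj (v i) (v (i + 1))) (ω : Boundary G) :
    ∃ j ≤ G.dist x y, height G o ω y - height G o ω x = 2 * (j : ℤ) - G.dist x y ∧
      ∀ i ≤ G.dist x y, ω ∈ cylinder G x (v i) ↔ i ≤ j := by
  obtain ⟨r, hr, hω⟩ : ∃ r : GeodesicRay G, r = Quotient.out (endpoint r) ∧ endpoint r = ω := by
    have h : endpoint (Quotient.out ω) = ω := Quotient.out_eq ω
    exact ⟨Quotient.out ω, by rw [h], h⟩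
  subst hω
  set d := G.dist x y
  -- Fix a vertex `z` of the half geodesic, so far away that it decides everything.
  obtain ⟨m, hm, hcyl⟩ : ∃ m, height G o (endpoint r) y - height G o (endpoint r) x =
      (G.dist x (r.vertex m) : ℤ) - G.dist y (r.vertex m) ∧
      ∀ i ∈ Finset.range (d + 1), (endpoint r ∈ cylinder G x (v i) ↔
        G.dist x (r.vertex m) = G.dist x (v i) + G.dist (v i) (r.vertex m)) := by
    refine ((eventually_height_sub_height hG o x y r hr).and
      ((Finset.eventually_all _).2 fun i _ => ?_)).exists
    rw [endpoint_mem_cylinder_iff hG]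
    obtain ⟨M₁, h₁⟩ := exists_dist_vertex_add hG r x
    obtain ⟨M₂, h₂⟩ := exists_dist_vertex_add hG r (v i)
    set M := max M₁ M₂
    have hc : ∀ m ≥ M, (G.dist x (r.vertex m) = G.dist x (v i) + G.dist (v i) (r.vertex m) ↔
        G.dist x (r.vertex M) = G.dist x (v i) + G.dist (v i) (r.vertex M)) := by
      intro m hm
      obtain ⟨m, rfl⟩ := Nat.exists_eq_add_of_le hm
      rw [h₁ M (le_max_left _ _), h₂ M (le_max_right _ _)]
      omega
    filter_upwards [eventually_ge_atTop M] with m hm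
    rw [hc m hm]
    constructor
    · intro h
      obtain ⟨k, hk, hk'⟩ := (h.and (eventually_ge_atTop M)).exists
      exact (hc k hk').1 hk
    · intro h
      filter_upwards [eventually_ge_atTop M] with k hk
      exact (hc k hk).2 h
  set z := r.vertex m
  -- Along the geodesic the distance to `z` decreases, and increases once it has increased.
  have hstep : ∀ i < d, G.dist z (v i) = G.dist z (v (i + 1)) + 1 ∨
      G.dist z (v (i + 1)) = G.dist z (v i) + 1 := fun i hi =>
    hG.dist_eq_dist_add_one_of_adj z (hadj i hi)
  have hup : ∀ i, i + 1 < d → G.dist z (v (i + 1)) = G.dist z (v i) + 1 →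
      G.dist z (v (i + 2)) = G.dist z (v (i + 1)) + 1 := by
    intro i hi h
    refine dist_succ_of_ne hG z (hadj i (by omega)) (hadj (i + 1) hi) (fun e => ?_) h
    have h₁ := hv i (by omega)
    have h₂ := hv (i + 2) (by omega)
    rw [← e] at h₂
    omega
  have hf : ∀ n ≤ d, ∃ j ≤ n, G.dist z (v n) + 2 * j = G.dist z x + n ∧
      (j < n → G.dist z (v n) = G.dist z (v (n - 1)) + 1) ∧
      ∀ i ≤ n, G.dist z x = i + G.dist z (v i) ↔ i ≤ j := by
    intro n
    induction n with
    | zero =>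
      intro _
      refine ⟨0, le_rfl, by rw [hv0], fun h => absurd h (lt_irrefl _), fun i hi => ?_⟩
      obtain rfl : i = 0 := by omega
      simp [hv0]
    | succ n ih =>
      intro hn
      obtain ⟨j, hj, h₁, h₂, h₃⟩ := ih (by omega)
      rcases hstep n (by omega) with h | h
      · have hjn : j = n := by
          by_contra hne
          have hlt : j < n := lt_of_le_of_ne hj hne
          obtain ⟨k, rfl⟩ : ∃ k, n = k + 1 := ⟨n - 1, by omega⟩
          have : G.dist z (v (k + 1 + 1)) = G.dist z (v (k + 1)) + 1 :=
            hup k (by omega) (by simpa using h₂ hlt)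
          omega
        subst hjn
        refine ⟨j + 1, le_rfl, by omega, fun h => absurd h (lt_irrefl _), fun i hi => ?_⟩
        rcases Nat.lt_or_ge i (j + 1) with hi' | hi'
        · have := h₃ i (by omega)
          omega
        · obtain rfl : i = j + 1 := by omega
          omega
      · refine ⟨j, by omega, by omega, fun _ => by simpa using h, fun i hi => ?_⟩
        rcases Nat.lt_or_ge i (n + 1) with hi' | hi'
        · exact h₃ i (by omega)
        · obtain rfl : i = n + 1 := by omega
          omega
  obtain ⟨j, hj, h₁, -, h₃⟩ := hf d le_rfl
  refine ⟨j, hj, ?_, fun i hi => ?_⟩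
  · rw [hvd] at h₁
    rw [hm, G.dist_comm (u := x), G.dist_comm (u := y)]
    omega
  · rw [hcyl i (Finset.mem_range.2 (by omega)), ← h₃ i hi, hv i hi, G.dist_comm (u := x),
      G.dist_comm (v := z)]

end Tree

/-! ### The topology of the boundary and the harmonic measures -/

section HarmonicMeasure

variable {V : Type u} {G : SimpleGraph V}

theorem countable_of_locallyFinite [G.LocallyFinite] (hG : G.Connected) : Countable V := by
  classical
  obtain ⟨x⟩ := hG.nonempty
  have hfin : ∀ n : ℕ, {v | G.dist x v = n}.Finite := by
    intro n
    induction n with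
    | zero =>
      refine (finite_singleton x).subset fun v hv => ?_
      exact ((hG.dist_eq_zero_iff).1 hv).symm
    | succ n ih =>
      refine (ih.biUnion fun w _ => (G.neighborFinset w).finite_toSet).subset fun v hv => ?_
      obtain ⟨p, -, -, hp, hadj⟩ := exists_geodesic hG x v
      have hd : G.dist x v = n + 1 := hv
      refine mem_biUnion (x := p n) (hp n (by omega)).1 ?_
      have h := hadj n (by omega)
      have h' : p (n + 1) = v := by
        have := (hp (n + 1) (by omega)).2
        exact hG.dist_eq_zero_iff.1 (by omega)
      simpa [h'] using h
  have : (⋃ n : ℕ, {v | G.dist x v = n}) = univ := eq_univ_of_forall fun v => by simp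
  exact countable_univ_iff.1 (this ▸ countable_iUnion fun n => (hfin n).countable)

theorem secondCountableTopology_boundary [Countable V] :
    SecondCountableTopology (Boundary G) := by
  refine ⟨⟨{s | ∃ x y, s = cylinder G x y}, ?_, rfl⟩⟩
  have : {s | ∃ x y, s = cylinder G x y} = range fun p : V × V => cylinder G p.1 p.2 := by
    ext s
    simp [eq_comm]
  rw [this]
  exact countable_range _

theorem measurableSet_cylinder (x y : V) : MeasurableSet (cylinder G x y) := by
  have h : IsOpen (cylinder G x y) :=
    TopologicalSpace.isOpen_generateFrom_of_mem (g := {s | ∃ x y, s = cylinder G x y}) ⟨x, y, rfl⟩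
  exact h.measurableSet

instance (x v : V) : DiscreteMeasurableSpace (Next G x v) :=
  ⟨fun _ => MeasurableSpace.measurableSet_top⟩

instance [G.LocallyFinite] (x v : V) : Finite (Next G x v) := by
  refine Finite.of_injective (β := G.neighborSet v) (fun η => ⟨η.vertex, η.adj⟩) fun η η' h => ?_
  exact Next.ext (congrArg Subtype.val h)

theorem card_next [G.LocallyFinite] (hG : G.IsTree) {q : ℕ} (hq : G.IsRegularOfDegree (q + 1))
    (x v : V) [Decidable (v = x)] : Nat.card (Next G x v) = if v = x then q + 1 else q := by
  classical
  let e : Next G x v ≃ ((G.neighborFinset v).filter fun w => G.dist x w = G.dist x v + 1) :=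
    { toFun := fun η => ⟨η.vertex, by simp [η.adj, η.dist_eq]⟩
      invFun := fun w => ⟨w, by simpa using (Finset.mem_filter.1 w.2).1,
        (Finset.mem_filter.1 w.2).2⟩
      left_inv := fun _ => rfl
      right_inv := fun _ => rfl }
  rw [Nat.card_congr e, Nat.card_eq_fintype_card, Fintype.card_coe]
  have hcard : (G.neighborFinset v).card = q + 1 := hq v
  split_ifs with h
  · subst h
    rw [Finset.filter_true_of_mem, hcard]
    intro w hw
    rw [SimpleGraph.dist_self, SimpleGraph.dist_eq_one_iff_adj.2 (by simpa using hw)]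
  · obtain ⟨p, -, hpd, hp, hadj⟩ := exists_geodesic hG.connected x v
    have hpos := hG.connected.pos_dist_of_ne (Ne.symm h)
    set n := G.dist x v - 1
    have hn : G.dist x v = n + 1 := by omega
    have hw : G.Adj v (p n) := by
      have := hadj n (by omega)
      rw [← hn, hpd] at this
      exact this.symm
    have hwd : G.dist x (p n) = n := (hp n (by omega)).1
    -- The only neighbour that is not farther from `x` is the previous vertex on the geodesic.
    have : (G.neighborFinset v).filter (fun w => G.dist x w = G.dist x v + 1) =
        (G.neighborFinset v).erase (p n) := by
      ext w
      simp only [Finset.mem_filter, Finset.mem_erase, SimpleGraph.mem_neighborFinset]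
      constructor
      · rintro ⟨h₁, h₂⟩
        refine ⟨?_, h₁⟩
        rintro rfl
        omega
      · rintro ⟨h₁, h₂⟩
        exact ⟨h₂, dist_succ_of_ne hG x hw.symm h₂ (Ne.symm h₁) (by omega)⟩
    rw [this, Finset.card_erase_of_mem (by simpa using hw), hcard]
    rfl

theorem nonempty_next [G.LocallyFinite] (hG : G.IsTree) {q : ℕ} (hq0 : 1 ≤ q)
    (hq : G.IsRegularOfDegree (q + 1)) (x v : V) : Nonempty (Next G x v) := by
  classical
  refine (Nat.card_pos_iff.1 ?_).1
  rw [card_next hG hq]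
  split_ifs <;> omega

theorem isProbabilityMeasure_uniformOn_next [G.LocallyFinite] (hG : G.IsTree) {q : ℕ}
    (hq0 : 1 ≤ q) (hq : G.IsRegularOfDegree (q + 1)) (x v : V) :
    IsProbabilityMeasure (ProbabilityTheory.uniformOn (univ : Set (Next G x v))) :=
  have := nonempty_next hG hq0 hq x v
  ProbabilityTheory.isProbabilityMeasure_uniformOn finite_univ univ_nonempty

theorem uniformOn_next_singleton [G.LocallyFinite] (x v : V) (η : Next G x v) :
    ProbabilityTheory.uniformOn (univ : Set (Next G x v)) {η} =
      ((Nat.card (Next G x v) : ℕ) : ℝ≥0∞)⁻¹ := by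
  have := Fintype.ofFinite (Next G x v)
  rw [ProbabilityTheory.uniformOn_univ, Measure.count_singleton, Nat.card_eq_fintype_card,
    one_div]

/-- As the vertices between `x` and `p n` are determined in a tree, the path through `p n` has made
all the choices along the geodesic `p`. -/
theorem followVertex_eq_iff {x : V} {p : ℕ → V} {n : ℕ} (hp0 : p 0 = x)
    (hp : ∀ i ≤ n, G.dist x (p i) = i) (ξ : ∀ v, Next G x v) (hG : G.IsTree)
    (hadj : ∀ i < n, G.Adj (p i) (p (i + 1))) :
    followVertex G x ξ n = p n ↔ ∀ i < n, (ξ (p i)).vertex = p (i + 1) := by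
  constructor
  · intro h
    have hback : ∀ k ≤ n, followVertex G x ξ (n - k) = p (n - k) := by
      intro k
      induction k with
      | zero => exact fun _ => h
      | succ k ih =>
        intro hk
        obtain ⟨j, hj⟩ : ∃ j, n - k = j + 1 := ⟨n - k - 1, by omega⟩
        have hj' : n - (k + 1) = j := by omega
        have ih := ih (by omega)
        rw [hj] at ih
        rw [hj']
        by_contra hne
        -- Both vertices are neighbours of `p (j + 1)` closer to `x`.
        have h₁ := (ξ (followVertex G x ξ j)).adj
        change G.Adj _ (followVertex G x ξ (j + 1)) at h₁
        rw [ih] at h₁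
        have h₂ := dist_succ_of_ne hG x h₁ (hadj j (by omega)).symm hne
          (by rw [hp _ (by omega), followVertex_dist])
        rw [hp _ (by omega), hp _ (by omega)] at h₂
        omega
    intro i hi
    have h₁ := hback (n - i) (by omega)
    have h₂ := hback (n - (i + 1)) (by omega)
    rw [show n - (n - i) = i by omega] at h₁
    rw [show n - (n - (i + 1)) = i + 1 by omega] at h₂
    rw [← h₂, ← h₁]
    rfl
  · intro h
    have : ∀ i ≤ n, followVertex G x ξ i = p i := by
      intro i
      induction i with
      | zero => exact fun _ => hp0.symm
      | succ i ih =>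
        intro hi
        rw [followVertex, ih (by omega), h i (by omega)]
    exact this n le_rfl

theorem endpoint_follow_mem_cylinder_iff (hG : G.IsTree) (x y : V) (ξ : ∀ v, Next G x v) :
    endpoint (follow G x ξ) ∈ cylinder G x y ↔ followVertex G x ξ (G.dist x y) = y := by
  constructor
  · intro h
    refine eq_of_mem_cylinder hG (ω := endpoint (follow G x ξ)) ⟨_, rfl, rfl, _, rfl⟩ h ?_
    exact followVertex_dist G x ξ _
  · exact fun h => ⟨follow G x ξ, rfl, rfl, _, h⟩

/-- The event that the random path passes through `p n` is a box: it prescribes the choices made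
at the vertices `p i`, `i < n`. -/
theorem setOf_followVertex_eq {x : V} {p : ℕ → V} {n : ℕ} (hG : G.IsTree) (hp0 : p 0 = x)
    (hp : ∀ i ≤ n, G.dist x (p i) = i) (hadj : ∀ i < n, G.Adj (p i) (p (i + 1)))
    [DecidableEq V] :
    {ξ : ∀ v, Next G x v | followVertex G x ξ n = p n} =
      Set.pi ((Finset.range n).image p) fun v => {η | η.vertex = p (G.dist x v + 1)} := by
  ext ξ
  rw [mem_ofPred_eq, followVertex_eq_iff hp0 hp ξ hG hadj]
  constructor
  · intro h v hv
    obtain ⟨i, hi, rfl⟩ := Finset.mem_image.1 (Finset.mem_coe.1 hv)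
    rw [Finset.mem_range] at hi
    rw [mem_ofPred_eq, h i hi, hp i hi.le]
  · intro h i hi
    have := h (p i) (Finset.mem_coe.2 (Finset.mem_image_of_mem _ (Finset.mem_range.2 hi)))
    rwa [mem_ofPred_eq, hp i hi.le] at this

theorem measurableSet_followVertex_eq (hG : G.IsTree) (x y : V) (n : ℕ) :
    MeasurableSet {ξ : ∀ v, Next G x v | followVertex G x ξ n = y} := by
  classical
  by_cases hn : G.dist x y = n
  · subst hn
    obtain ⟨p, hp0, hpd, hp, hadj⟩ := exists_geodesic hG.connected x y
    have := setOf_followVertex_eq hG hp0 (fun i hi => (hp i hi).1) hadj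
    rw [hpd] at this
    rw [this]
    exact MeasurableSet.pi (Finset.countable_toSet _) fun v _ => MeasurableSet.of_discrete
  · convert MeasurableSet.empty
    refine eq_empty_of_forall_notMem fun ξ hξ => hn ?_
    rw [mem_ofPred_eq] at hξ
    rw [← hξ, followVertex_dist]

/-- The countably many cylinders generate the Borel `σ`-algebra, and membership of a cylinder is
decided by the distances to the vertices of the path. -/
theorem measurable_endpoint_follow [Countable V] (hG : G.IsTree) (x : V) :
    Measurable fun ξ : ∀ v, Next G x v => endpoint (follow G x ξ) := by
  have := secondCountableTopology_boundary (G := G)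
  change Measurable[_, borel (Boundary G)] _
  rw [borel_eq_generateFrom_of_subbasis (s := {s | ∃ x y, s = cylinder G x y}) rfl]
  refine measurable_generateFrom ?_
  rintro _ ⟨x', y', rfl⟩
  have hfv : ∀ m (P : V → Prop),
      MeasurableSet {ξ : ∀ v, Next G x v | P (followVertex G x ξ m)} := by
    intro m P
    have : {ξ : ∀ v, Next G x v | P (followVertex G x ξ m)} =
        ⋃ v ∈ {v | P v}, {ξ | followVertex G x ξ m = v} := by
      ext ξ
      simp
    rw [this]
    exact MeasurableSet.biUnion (to_countable _)
      fun v _ => measurableSet_followVertex_eq hG x v m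
  have : (fun ξ : ∀ v, Next G x v => endpoint (follow G x ξ)) ⁻¹' cylinder G x' y' =
      ⋃ M : ℕ, ⋂ m ∈ Ici M, {ξ | G.dist x' (followVertex G x ξ m) =
        G.dist x' y' + G.dist y' (followVertex G x ξ m)} := by
    ext ξ
    rw [mem_preimage, endpoint_mem_cylinder_iff hG, eventually_atTop]
    simp [follow]
  rw [this]
  exact MeasurableSet.iUnion fun M => MeasurableSet.biInter (to_countable _)
    fun m _ => hfv m fun v => G.dist x' v = G.dist x' y' + G.dist y' v

theorem isProbabilityMeasure_boundaryMeasure [G.LocallyFinite] (hG : G.IsTree) {q : ℕ}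
    (hq0 : 1 ≤ q) (hq : G.IsRegularOfDegree (q + 1)) (x : V) :
    IsProbabilityMeasure (boundaryMeasure G x) := by
  have := countable_of_locallyFinite hG.connected
  have := isProbabilityMeasure_uniformOn_next hG hq0 hq x
  exact Measure.isProbabilityMeasure_map (measurable_endpoint_follow hG x).aemeasurable

/-- The cylinder is the event that `n + 1` independent uniform choices, one among `q + 1` and `n`
among `q` neighbours, take prescribed values. -/
theorem boundaryMeasure_cylinder [G.LocallyFinite] (hG : G.IsTree) {q : ℕ} (hq0 : 1 ≤ q)
    (hq : G.IsRegularOfDegree (q + 1)) {x y : V} {n : ℕ} (hn : G.dist x y = n + 1) :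
    (boundaryMeasure G x).real (cylinder G x y) = ((q + 1) * q ^ n : ℝ)⁻¹ := by
  classical
  have := countable_of_locallyFinite hG.connected
  have := isProbabilityMeasure_uniformOn_next hG hq0 hq x
  obtain ⟨p, hp0, hpd, hp, hadj⟩ := exists_geodesic hG.connected x y
  have hbox := setOf_followVertex_eq hG hp0 (fun i hi => (hp i hi).1) hadj
  rw [hpd, hn] at hbox
  have hpre : (fun ξ : ∀ v, Next G x v => endpoint (follow G x ξ)) ⁻¹' cylinder G x y =
      {ξ | followVertex G x ξ (n + 1) = y} := by
    ext ξ
    rw [mem_preimage, endpoint_follow_mem_cylinder_iff hG, hn, mem_ofPred_eq]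
  have hinj : Set.InjOn p (Finset.range (n + 1)) := by
    intro i hi j hj h
    rw [Finset.mem_coe, Finset.mem_range] at hi hj
    rw [← (hp i (by omega)).1, ← (hp j (by omega)).1, h]
  have hfac : ∀ i < n + 1, ProbabilityTheory.uniformOn (univ : Set (Next G x (p i)))
      {η | η.vertex = p (G.dist x (p i) + 1)} =
      (((if i = 0 then q + 1 else q : ℕ) : ℝ≥0∞))⁻¹ := by
    intro i hi
    have h₁ := (hp i (by omega)).1
    have h₂ := (hp (i + 1) (by omega)).1
    have : {η : Next G x (p i) | η.vertex = p (G.dist x (p i) + 1)} =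
        {⟨p (i + 1), hadj i (by omega), by omega⟩} := by
      ext η
      simp only [mem_ofPred_eq, mem_singleton_iff, Next.ext_iff, h₁]
    rw [this, uniformOn_next_singleton, card_next hG hq]
    have : p i = x ↔ i = 0 := by
      constructor
      · intro h
        rw [h, SimpleGraph.dist_self] at h₁
        exact h₁.symm
      · rintro rfl
        exact hp0
    simp only [this]
  rw [measureReal_def, boundaryMeasure, Measure.map_apply (measurable_endpoint_follow hG x)
    (measurableSet_cylinder x y), hpre, hbox, Measure.infinitePi_pi _
    (fun _ _ => MeasurableSet.of_discrete), Finset.prod_image hinj,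
    Finset.prod_congr rfl fun i hi => hfac i (Finset.mem_range.1 hi), Finset.prod_range_succ']
  have : ((q : ℝ≥0∞) + 1).toReal = q + 1 := by
    rw [ENNReal.toReal_add (ENNReal.natCast_ne_top q) ENNReal.one_ne_top]
    simp
  simp [ENNReal.toReal_inv, mul_comm, this]

end HarmonicMeasure

/-! ### Oscillatory integrals -/

section Oscillation

open scoped ContDiff

/-- The oscillating factor `e^{i m L s}`; for `L = log q` it is `q^{i m s}`. -/
noncomputable def wave (L : ℝ) (m : ℤ) (s : ℝ) : ℂ := Complex.exp ((m * (L * s) : ℝ) * Complex.I)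

theorem norm_wave (L : ℝ) (m : ℤ) (s : ℝ) : ‖wave L m s‖ = 1 := Complex.norm_exp_ofReal_mul_I _

theorem wave_ne_zero (L : ℝ) (m : ℤ) (s : ℝ) : wave L m s ≠ 0 := Complex.exp_ne_zero _

theorem wave_add (L : ℝ) (m n : ℤ) (s : ℝ) : wave L (m + n) s = wave L m s * wave L n s := by
  rw [wave, wave, wave, ← Complex.exp_add]
  congr 1
  push_cast
  ring

theorem wave_eq_zpow (L : ℝ) (m : ℤ) (s : ℝ) : wave L m s = wave L 1 s ^ m := by
  rw [wave, wave, ← Complex.exp_int_mul]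
  congr 1
  push_cast
  ring

theorem contDiff_wave (L : ℝ) (m : ℤ) : ContDiff ℝ ∞ (wave L m) := by
  unfold wave
  exact ((Complex.ofRealCLM.contDiff.comp
    (contDiff_const.mul (contDiff_const.mul contDiff_id))).mul contDiff_const).cexp

theorem hasDerivAt_wave (L : ℝ) (m : ℤ) (s : ℝ) :
    HasDerivAt (wave L m) (m * L * Complex.I * wave L m s) s := by
  have h : HasDerivAt (fun s : ℝ => (m * (L * s) : ℝ)) (m * (L * 1)) s :=
    ((hasDerivAt_id s).const_mul L).const_mul (m : ℝ)
  refine (h.ofReal_comp.mul_const Complex.I).cexp.congr_deriv ?_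
  simp only [wave]
  push_cast
  ring

/-- Repeated integration by parts: the coefficient of frequency `m` of `a g` decays like
`|m|^{-k}`, with a constant that depends on the amplitude `a` only through bounds for its first
`k` derivatives. The derivatives `A j` of `a = A 0` vanish at both end points, so that there are
no boundary terms. -/
theorem exists_norm_integral_wave_le {L T : ℝ} (hL : 0 < L) (hT : 0 < T) (k : ℕ) :
    ∀ g : ℝ → ℂ, ContDiff ℝ ∞ g → ∃ C : ℝ, 0 ≤ C ∧ ∀ (A : ℕ → ℝ → ℂ) (M : ℝ),
      (∀ j, ∀ s ∈ Icc 0 T, HasDerivWithinAt (A j) (A (j + 1) s) (Icc 0 T) s) →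
      (∀ j, A j 0 = 0 ∧ A j T = 0) → (∀ j ≤ k, ∀ s ∈ Icc 0 T, ‖A j s‖ ≤ M) →
      ∀ m : ℤ, ‖∫ s in (0 : ℝ)..T, wave L m s * (A 0 s * g s)‖ ≤ C * M / (1 + |(m : ℝ)|) ^ k := by
  have triv : ∀ g : ℝ → ℂ, ContDiff ℝ ∞ g → ∃ C : ℝ, 0 ≤ C ∧ ∀ (a : ℝ → ℂ) (M : ℝ),
      (∀ s ∈ Icc 0 T, ‖a s‖ ≤ M) →
      ∀ m : ℤ, ‖∫ s in (0 : ℝ)..T, wave L m s * (a s * g s)‖ ≤ C * M := by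
    intro g hg
    obtain ⟨D, hD⟩ := isCompact_Icc.exists_bound_of_continuousOn (s := Icc 0 T)
      hg.continuous.continuousOn
    have hD0 : 0 ≤ D := (norm_nonneg _).trans (hD 0 ⟨le_rfl, hT.le⟩)
    refine ⟨D * T, by positivity, fun a M ha m => ?_⟩
    have h0 : 0 ≤ M := (norm_nonneg _).trans (ha 0 ⟨le_rfl, hT.le⟩)
    refine (intervalIntegral.norm_integral_le_of_norm_le_const (C := M * D)
      fun s hs => ?_).trans_eq ?_
    · rw [uIoc_of_le hT.le] at hs
      rw [norm_mul, norm_wave, one_mul, norm_mul]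
      exact mul_le_mul (ha s (Ioc_subset_Icc_self hs)) (hD s (Ioc_subset_Icc_self hs))
        (norm_nonneg _) h0
    · rw [sub_zero, abs_of_pos hT]
      ring
  induction k with
  | zero =>
    intro g hg
    obtain ⟨C, hC, h⟩ := triv g hg
    refine ⟨C, hC, fun A M _ _ hM m => ?_⟩
    rw [pow_zero, div_one]
    exact h (A 0) M (hM 0 le_rfl) m
  | succ k ih =>
    intro g hg
    have hg' : ContDiff ℝ ∞ (deriv g) := (contDiff_infty_iff_deriv.1 hg).2
    obtain ⟨C₀, hC₀, h₀⟩ := triv g hg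
    obtain ⟨C₁, hC₁, h₁⟩ := ih g hg
    obtain ⟨C₂, hC₂, h₂⟩ := ih (deriv g) hg'
    refine ⟨C₀ + 2 / L * (C₁ + C₂), by positivity, fun A M hA hA0 hM m => ?_⟩
    have hM0 : 0 ≤ M := (norm_nonneg _).trans (hM 0 (Nat.zero_le _) 0 ⟨le_rfl, hT.le⟩)
    rcases eq_or_ne m 0 with rfl | hm
    · refine (h₀ (A 0) M (hM 0 (Nat.zero_le _)) 0).trans ?_
      simp only [Int.cast_zero, abs_zero, add_zero, one_pow, div_one]
      refine mul_le_mul_of_nonneg_right ?_ hM0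
      have : 0 ≤ 2 / L * (C₁ + C₂) := by positivity
      linarith
    have i₁ := h₁ (fun j => A (j + 1)) M (fun j => hA (j + 1)) (fun j => hA0 (j + 1))
      (fun j hj => hM (j + 1) (by omega)) m
    have i₂ := h₂ A M hA hA0 (fun j hj => hM j (by omega)) m
    have hc : ∀ j, ContinuousOn (A j) (Icc 0 T) := fun j s hs => (hA j s hs).continuousWithinAt
    have hwc : Continuous (wave L m) := (contDiff_wave L m).continuous
    have hint : ∀ f : ℝ → ℂ, ContinuousOn f (Icc 0 T) → IntervalIntegrable f volume 0 T :=
      fun f hf => hf.intervalIntegrable_of_Icc hT.le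
    have c₀ : ContinuousOn (fun s => wave L m s * (A 0 s * g s)) (Icc 0 T) :=
      hwc.continuousOn.mul ((hc 0).mul hg.continuous.continuousOn)
    have c₁ : ContinuousOn (fun s => wave L m s * (A 1 s * g s)) (Icc 0 T) :=
      hwc.continuousOn.mul ((hc 1).mul hg.continuous.continuousOn)
    have c₂ : ContinuousOn (fun s => wave L m s * (A 0 s * deriv g s)) (Icc 0 T) :=
      hwc.continuousOn.mul ((hc 0).mul hg'.continuous.continuousOn)
    have c₀' : ContinuousOn (fun s => m * L * Complex.I * (wave L m s * (A 0 s * g s)))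
      (Icc 0 T) := continuousOn_const.mul c₀
    have c₁₂ : ContinuousOn (fun s => wave L m s * (A 1 s * g s) +
      wave L m s * (A 0 s * deriv g s)) (Icc 0 T) := c₁.add c₂
    have parts := intervalIntegral.integral_eq_sub_of_hasDerivAt_of_le hT.le c₀
      (f' := fun s => m * L * Complex.I * (wave L m s * (A 0 s * g s)) +
        (wave L m s * (A 1 s * g s) + wave L m s * (A 0 s * deriv g s))) (fun s hs => by
          have hd := (hA 0 s (Ioo_subset_Icc_self hs)).hasDerivAt (Icc_mem_nhds hs.1 hs.2)
          have hgd := (hg.differentiable (by simp) s).hasDerivAt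
          refine ((hasDerivAt_wave L m s).mul (hd.mul hgd)).congr_deriv ?_
          simp only [Pi.mul_apply, zero_add]
          ring)
      (hint _ (c₀'.add c₁₂))
    rw [(hA0 0).1, (hA0 0).2, intervalIntegral.integral_add (hint _ c₀') (hint _ c₁₂),
      intervalIntegral.integral_const_mul,
      intervalIntegral.integral_add (hint _ c₁) (hint _ c₂)] at parts
    simp only [zero_mul, mul_zero, sub_zero] at parts
    set I₀ := ∫ s in (0 : ℝ)..T, wave L m s * (A 0 s * g s)
    set I₁ := ∫ s in (0 : ℝ)..T, wave L m s * (A 1 s * g s)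
    set I₂ := ∫ s in (0 : ℝ)..T, wave L m s * (A 0 s * deriv g s)
    have hm1 : (1 : ℝ) ≤ |(m : ℝ)| := by exact_mod_cast Int.one_le_abs hm
    have hbound : |(m : ℝ)| * L * ‖I₀‖ ≤ (C₁ + C₂) * M / (1 + |(m : ℝ)|) ^ k := by
      have e : m * L * Complex.I * I₀ = -(I₁ + I₂) := by linear_combination parts
      have e' := congrArg norm e
      rw [norm_neg, norm_mul, norm_mul, norm_mul, Complex.norm_I, Complex.norm_intCast,
        Complex.norm_real, Real.norm_of_nonneg hL.le, mul_one] at e'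
      rw [e']
      refine (norm_add_le _ _).trans ((add_le_add i₁ i₂).trans_eq ?_)
      ring
    have hp : (0 : ℝ) < (1 + |(m : ℝ)|) ^ k := by positivity
    rw [le_div_iff₀ hp] at hbound
    rw [pow_succ, le_div_iff₀ (by positivity)]
    -- `1 + |m| ≤ 2 |m|`.
    have h₃ : ‖I₀‖ * ((1 + |(m : ℝ)|) ^ k * (1 + |(m : ℝ)|)) ≤
        2 / L * (|(m : ℝ)| * L * ‖I₀‖ * (1 + |(m : ℝ)|) ^ k) := by
      have : 2 / L * (|(m : ℝ)| * L * ‖I₀‖ * (1 + |(m : ℝ)|) ^ k) =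
          ‖I₀‖ * ((1 + |(m : ℝ)|) ^ k * (2 * |(m : ℝ)|)) := by field_simp
      rw [this]
      gcongr
      linarith
    refine h₃.trans ((mul_le_mul_of_nonneg_left hbound (by positivity)).trans ?_)
    have : 0 ≤ C₀ * M := by positivity
    linarith

end Oscillation

/-! ### The Plancherel density -/

section Plancherel

open scoped ContDiff

/-- With `w = q^{2is}`, the Plancherel density is
`c₀ (1 - w) (1 - w⁻¹) / ((q w - 1) (q w⁻¹ - 1))`. This is the part `c₀ (1 - w⁻¹) / (q w⁻¹ - 1)`. -/
noncomputable def densityFactor (q : ℕ) (s : ℝ) : ℂ :=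
  ((q * (q + 1) * Real.log q / (4 * Real.pi) : ℝ) : ℂ) * (1 - wave (Real.log q) (-2) s) /
    (q * wave (Real.log q) (-2) s - 1)

/-- The product of the Plancherel density with `q w - 1`, where `w = q^{2is}`. -/
noncomputable def numeratorDensity (q : ℕ) (s : ℝ) : ℂ :=
  (1 - wave (Real.log q) 2 s) * densityFactor q s

theorem natCast_mul_wave_sub_one_ne_zero {q : ℕ} (hq : 2 ≤ q) (L : ℝ) (m : ℤ) (s : ℝ) :
    (q : ℂ) * wave L m s - 1 ≠ 0 := by
  intro h
  have := congrArg norm (sub_eq_zero.1 h)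
  rw [norm_mul, norm_wave, norm_one, mul_one, Complex.norm_natCast] at this
  have : q = 1 := by exact_mod_cast this
  omega

theorem contDiff_densityFactor {q : ℕ} (hq : 2 ≤ q) : ContDiff ℝ ∞ (densityFactor q) := by
  unfold densityFactor
  simp only [div_eq_mul_inv]
  exact (contDiff_const.mul (contDiff_const.sub (contDiff_wave _ _))).mul
    (((contDiff_const.mul (contDiff_wave _ _)).sub contDiff_const).inv
      fun s => natCast_mul_wave_sub_one_ne_zero hq _ _ s)

theorem contDiff_numeratorDensity {q : ℕ} (hq : 2 ≤ q) : ContDiff ℝ ∞ (numeratorDensity q) :=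
  (contDiff_const.sub (contDiff_wave _ _)).mul (contDiff_densityFactor hq)

theorem natCast_cpow_add_mul_I {q : ℕ} (hq : 2 ≤ q) (t s : ℝ) (m : ℤ) :
    (q : ℂ) ^ ((t : ℂ) + Complex.I * (m * s)) =
      (((q : ℝ) ^ t : ℝ) : ℂ) * wave (Real.log q) m s := by
  have hq0 : (q : ℂ) ≠ 0 := by exact_mod_cast (by omega : q ≠ 0)
  rw [Complex.cpow_add _ _ hq0, Complex.ofReal_cpow (Nat.cast_nonneg q), Complex.ofReal_natCast,
    Complex.cpow_def_of_ne_zero hq0 (Complex.I * _), Complex.natCast_log.symm, wave]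
  congr 2
  push_cast
  ring

/-- Where `w = q^{2is}` is `1`, in particular at both end points of `[0, τ]`, both sides vanish: on
the left the value of `c` there is a division by zero, and the identity still holds. -/
theorem plancherelDensity_eq {q : ℕ} (hq : 2 ≤ q) (s : ℝ) :
    (plancherelDensity q s : ℂ) =
      numeratorDensity q s / (q * wave (Real.log q) 2 s - 1) := by
  have hqr : (0 : ℝ) < q := by exact_mod_cast (by omega : 0 < q)
  set L := Real.log q
  set u := wave L 1 s with hu
  have hu0 : u ≠ 0 := wave_ne_zero _ _ _
  have huc : (starRingEnd ℂ) u = u⁻¹ := by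
    rw [Complex.inv_def, Complex.normSq_eq_norm_sq, norm_wave]
    simp
  set r : ℝ := (q : ℝ) ^ (1 / 2 : ℝ) with hr
  have hr0 : 0 < r := Real.rpow_pos_of_pos hqr _
  have hrr : r * r = q := by
    rw [hr, ← Real.rpow_add hqr]
    norm_num
  have hr' : (q : ℝ) ^ (-1 / 2 : ℝ) = r⁻¹ := by
    rw [hr, ← Real.rpow_neg hqr.le]
    norm_num
  have hneg : wave L (-1) s = u⁻¹ := by rw [wave_eq_zpow, zpow_neg_one]
  have e₁ : (q : ℂ) ^ (1 / 2 + Complex.I * s) = r * u := by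
    have := natCast_cpow_add_mul_I hq (1 / 2) s 1
    push_cast at this
    rwa [one_mul] at this
  have e₂ : (q : ℂ) ^ (-1 / 2 - Complex.I * s) = (r : ℂ)⁻¹ * u⁻¹ := by
    have := natCast_cpow_add_mul_I hq (-1 / 2) s (-1)
    rw [hr', hneg] at this
    push_cast at this
    rw [← this]
    congr 1
    ring
  have e₃ : (q : ℂ) ^ (Complex.I * s) = u := by
    have := natCast_cpow_add_mul_I hq 0 s 1
    rw [Real.rpow_zero] at this
    push_cast at this
    rwa [one_mul, one_mul, zero_add] at this
  have e₄ : (q : ℂ) ^ (-(Complex.I * s)) = u⁻¹ := by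
    rw [Complex.cpow_neg, e₃]
  have e₅ : (q : ℂ) ^ (1 / 2 : ℂ) = r := by
    rw [hr, Complex.ofReal_cpow hqr.le]
    norm_num
  have hsq : ∀ z : ℂ, ((‖z‖ ^ 2 : ℝ) : ℂ) = z * (starRingEnd ℂ) z := fun z => by
    rw [Complex.mul_conj, Complex.normSq_eq_norm_sq]
  have hw : wave L 2 s = u ^ 2 := by rw [wave_eq_zpow]; norm_cast
  have hw' : wave L (-2) s = (u ^ 2)⁻¹ := by rw [wave_eq_zpow, zpow_neg]; norm_cast
  have hd₁ := natCast_mul_wave_sub_one_ne_zero hq L 2 s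
  have hd₂ := natCast_mul_wave_sub_one_ne_zero hq L (-2) s
  rw [plancherelDensity, numeratorDensity, densityFactor, cFunction, e₁, e₂, e₃, e₄, e₅]
  rw [hw, hw'] at *
  rw [Complex.ofReal_mul, Complex.ofReal_inv, hsq]
  simp only [map_mul, map_div₀, map_sub, map_add, map_inv₀, huc, Complex.conj_ofReal, map_natCast,
    map_one, inv_inv]
  have hqc : (q : ℂ) = r * r := by rw [← Complex.ofReal_mul, hrr]; simp
  have hrc : (r : ℂ) ≠ 0 := by exact_mod_cast hr0.ne'
  have hq1 : (q : ℂ) + 1 ≠ 0 := by exact_mod_cast (by omega : q + 1 ≠ 0)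
  have hpi : (Real.pi : ℂ) ≠ 0 := by exact_mod_cast Real.pi_ne_zero
  have hnum : ((r : ℂ) * u - (r : ℂ)⁻¹ * u⁻¹) * ((r : ℂ) * u⁻¹ - (r : ℂ)⁻¹ * u) =
      (q : ℂ)⁻¹ * ((q * u ^ 2 - 1) * (q * (u ^ 2)⁻¹ - 1)) := by
    rw [hqc]
    field_simp
  have hden : (u - u⁻¹) * (u⁻¹ - u) = (1 - u ^ 2) * (1 - (u ^ 2)⁻¹) := by
    field_simp
  have hc : ((r : ℂ) / (q + 1) * ((r * u - (r : ℂ)⁻¹ * u⁻¹) / (u - u⁻¹)) *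
      ((r : ℂ) / (q + 1) * ((r * u⁻¹ - (r : ℂ)⁻¹ * u) / (u⁻¹ - u))))⁻¹ =
      (q + 1) ^ 2 / q * ((1 - u ^ 2) * (1 - (u ^ 2)⁻¹) /
        ((q : ℂ)⁻¹ * ((q * u ^ 2 - 1) * (q * (u ^ 2)⁻¹ - 1)))) := by
    rw [← hden, ← hnum, mul_mul_mul_comm, div_mul_div_comm, div_mul_div_comm, mul_inv, inv_div,
      inv_div, ← hqc, sq]
  rw [hc]
  push_cast
  have hqc0 : (q : ℂ) ≠ 0 := by exact_mod_cast hqr.ne'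
  generalize 1 - (u ^ 2)⁻¹ = α
  generalize q * (u ^ 2)⁻¹ - 1 = β at *
  generalize q * u ^ 2 - 1 = γ at *
  generalize 1 - u ^ 2 = δ
  field_simp

theorem period_pos {q : ℕ} (hq : 2 ≤ q) : 0 < period q :=
  div_pos Real.pi_pos (Real.log_pos (by exact_mod_cast (by omega : 1 < q)))

theorem contDiff_plancherelDensity {q : ℕ} (hq : 2 ≤ q) :
    ContDiff ℝ ∞ fun s => (plancherelDensity q s : ℂ) := by
  have : (fun s => (plancherelDensity q s : ℂ)) =
      fun s => numeratorDensity q s * (q * wave (Real.log q) 2 s - 1)⁻¹ :=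
    funext fun s => by rw [plancherelDensity_eq hq, div_eq_mul_inv]
  rw [this]
  exact (contDiff_numeratorDensity hq).mul
    (((contDiff_const.mul (contDiff_wave _ _)).sub contDiff_const).inv
      fun s => natCast_mul_wave_sub_one_ne_zero hq _ _ s)

end Plancherel

/-! ### Averages of oscillatory integrals over nested sets -/

section Averages

variable {Ω : Type u}

/-- The oscillatory integral `∫_0^T e^{i m L s} a(ω, s) g(s) ds`, as a function of `ω`. -/
noncomputable def waveIntegral (L T : ℝ) (a : Ω → ℝ → ℂ) (g : ℝ → ℂ) (m : ℤ) (ω : Ω) : ℂ :=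
  ∫ s in (0 : ℝ)..T, wave L m s * (a ω s * g s)

theorem waveIntegral_numeratorDensity {q : ℕ} (hq : 2 ≤ q) {T : ℝ} (hT : 0 ≤ T)
    {a : Ω → ℝ → ℂ} (hc : ∀ ω, ContinuousOn (a ω) (Icc 0 T)) (m : ℤ) (ω : Ω) :
    waveIntegral (Real.log q) T a (numeratorDensity q) m ω =
      waveIntegral (Real.log q) T a (densityFactor q) m ω -
        waveIntegral (Real.log q) T a (densityFactor q) (m + 2) ω := by
  have hint : ∀ m, IntervalIntegrable
      (fun s => wave (Real.log q) m s * (a ω s * densityFactor q s)) volume 0 T := fun m =>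
    ((contDiff_wave _ m).continuous.continuousOn.mul
      ((hc ω).mul (contDiff_densityFactor hq).continuous.continuousOn)).intervalIntegrable_of_Icc hT
  rw [waveIntegral, waveIntegral, waveIntegral, ← intervalIntegral.integral_sub (hint _) (hint _)]
  congr 1 with s
  rw [numeratorDensity, wave_add]
  ring

theorem sum_Ico_sub_succ (f : ℕ → ℂ) {n d : ℕ} (h : n ≤ d) :
    ∑ i ∈ Finset.Ico n d, (f i - f (i + 1)) = f n - f d := by
  induction d, h using Nat.le_induction with
  | base => simp
  | succ d h ih => rw [Finset.sum_Ico_succ_top h, ih]; ring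

variable [MeasurableSpace Ω] {ν : Measure Ω}

theorem norm_setAverage_le [IsFiniteMeasure ν] {S : Set Ω} {f : Ω → ℂ} {b : ℝ}
    (hb : 0 ≤ b) (h : ∀ ω ∈ S, ‖f ω‖ ≤ b) : ‖⨍ ω in S, f ω ∂ν‖ ≤ b := by
  rw [setAverage_eq, norm_smul, norm_inv, Real.norm_of_nonneg measureReal_nonneg]
  have h₁ := norm_setIntegral_le_of_norm_le_const (μ := ν) (measure_lt_top ν S) h
  refine (mul_le_mul_of_nonneg_left h₁ (inv_nonneg.2 measureReal_nonneg)).trans ?_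
  rw [mul_left_comm]
  exact mul_le_of_le_one_right hb inv_mul_le_one

theorem norm_setIntegral_sub_le [IsFiniteMeasure ν] {S : Set Ω} {f : Ω → ℂ}
    (hf : Integrable f ν) {c : ℂ} {b : ℝ} (h : ∀ ω ∈ S, ‖f ω - c‖ ≤ b) :
    ‖∫ ω in S, f ω ∂ν - ν.real S * c‖ ≤ b * ν.real S := by
  have : ∫ ω in S, f ω ∂ν - ν.real S * c = ∫ ω in S, (f ω - c) ∂ν := by
    rw [integral_sub hf.integrableOn (integrable_const c)]
    simp
  rw [this]
  exact norm_setIntegral_le_of_norm_le_const (measure_lt_top ν S) h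

variable {L T M : ℝ} {a : Ω → ℝ → ℂ} {g : ℝ → ℂ}

theorem integrable_wave_mul_prod [IsProbabilityMeasure ν]
    (ha : AEStronglyMeasurable (Function.uncurry a) (ν.prod (volume.restrict (Ioc 0 T))))
    (hM : ∀ ω, ∀ s ∈ Icc 0 T, ‖a ω s‖ ≤ M) (hg : Continuous g) (m : ℤ) :
    Integrable (Function.uncurry fun ω s => wave L m s * (a ω s * g s))
      (ν.prod (volume.restrict (Ioc 0 T))) := by
  obtain ⟨D, hD⟩ := isCompact_Icc.exists_bound_of_continuousOn (s := Icc 0 T) hg.continuousOn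
  have hmem : ∀ᵐ p ∂ν.prod (volume.restrict (Ioc (0 : ℝ) T)), p.2 ∈ Ioc 0 T :=
    Measure.quasiMeasurePreserving_snd.ae (ae_restrict_mem measurableSet_Ioc)
  refine Integrable.of_bound (C := M * D) ?_ ?_
  · have h₁ : Continuous fun p : ℝ => wave L m p := (contDiff_wave L m).continuous
    exact (h₁.measurable.comp measurable_snd).aestronglyMeasurable.mul
      (ha.mul (hg.measurable.comp measurable_snd).aestronglyMeasurable)
  · filter_upwards [hmem] with p hp
    have hp' := Ioc_subset_Icc_self hp
    obtain ⟨ω, s⟩ := p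
    rw [Function.uncurry_apply_pair, norm_mul, norm_wave, one_mul, norm_mul]
    exact mul_le_mul (hM _ _ hp') (hD _ hp') (norm_nonneg _)
      ((norm_nonneg _).trans (hM ω _ hp'))

theorem integrable_waveIntegral [IsProbabilityMeasure ν] (hT : 0 ≤ T)
    (ha : AEStronglyMeasurable (Function.uncurry a) (ν.prod (volume.restrict (Ioc 0 T))))
    (hM : ∀ ω, ∀ s ∈ Icc 0 T, ‖a ω s‖ ≤ M) (hg : Continuous g) (m : ℤ) :
    Integrable (waveIntegral L T a g m) ν := by
  have := (integrable_wave_mul_prod (L := L) ha hM hg m).integral_prod_left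
  unfold waveIntegral
  simp only [intervalIntegral.integral_of_le hT]
  exact this

/-- Averaging over `S` commutes with the oscillatory integral, so that the latter inherits the
regularity of `a` in `ω`. -/
theorem norm_waveIntegral_sub_setAverage_le [IsProbabilityMeasure ν] (hT : 0 ≤ T)
    (ha : AEStronglyMeasurable (Function.uncurry a) (ν.prod (volume.restrict (Ioc 0 T))))
    (hM : ∀ ω, ∀ s ∈ Icc 0 T, ‖a ω s‖ ≤ M) (hc : ∀ ω, ContinuousOn (a ω) (Icc 0 T))
    (hg : Continuous g) {D : ℝ} (hD : ∀ s ∈ Icc 0 T, ‖g s‖ ≤ D) (m : ℤ) {S : Set Ω} {ω : Ω}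
    {ε : ℝ} (hε : 0 ≤ ε) (h : ∀ s ∈ Icc 0 T, ‖a ω s - ⨍ ω' in S, a ω' s ∂ν‖ ≤ ε) :
    ‖waveIntegral L T a g m ω - ⨍ ω' in S, waveIntegral L T a g m ω' ∂ν‖ ≤ ε * D * T := by
  have hint := integrable_wave_mul_prod (L := L) ha hM hg m
  have hintS : Integrable (Function.uncurry fun ω s => wave L m s * (a ω s * g s))
      ((ν.restrict S).prod (volume.restrict (Ioc 0 T))) :=
    hint.mono_measure (Measure.prod_mono Measure.restrict_le_self le_rfl)
  have hswap : ⨍ ω' in S, waveIntegral L T a g m ω' ∂ν =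
      ∫ s in (0 : ℝ)..T, wave L m s * ((⨍ ω' in S, a ω' s ∂ν) * g s) := by
    rw [setAverage_eq]
    unfold waveIntegral
    simp only [intervalIntegral.integral_of_le hT]
    rw [integral_integral_swap hintS, ← integral_smul]
    congr 1 with s
    rw [setAverage_eq, integral_const_mul, integral_mul_const, smul_mul_assoc, mul_smul_comm]
  have hintω : IntervalIntegrable (fun s => wave L m s * (a ω s * g s)) volume 0 T :=
    ((contDiff_wave L m).continuous.continuousOn.mul
      ((hc ω).mul hg.continuousOn)).intervalIntegrable_of_Icc hT
  have hintA : IntervalIntegrable (fun s => wave L m s * ((⨍ ω' in S, a ω' s ∂ν) * g s))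
      volume 0 T := by
    rw [intervalIntegrable_iff_integrableOn_Ioc_of_le hT]
    refine (hintS.integral_prod_right.smul (ν.real S)⁻¹).congr (ae_of_all _ fun s => ?_)
    simp only [Function.uncurry_apply_pair]
    rw [Pi.smul_apply, setAverage_eq, integral_const_mul, integral_mul_const, smul_mul_assoc,
      mul_smul_comm]
  rw [hswap, waveIntegral, ← intervalIntegral.integral_sub hintω hintA]
  refine (intervalIntegral.norm_integral_le_of_norm_le_const (C := ε * D)
    fun s hs => ?_).trans_eq ?_
  · rw [uIoc_of_le hT] at hs
    have hs' := Ioc_subset_Icc_self hs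
    rw [← mul_sub, ← sub_mul, norm_mul, norm_wave, one_mul, norm_mul]
    exact mul_le_mul (h s hs') (hD s hs') (norm_nonneg _) hε
  · rw [sub_zero, abs_of_nonneg hT]

/-- The decay of the kernel without the factor `q^{-d/2}`, for nested sets `B 0 ⊇ B 1 ⊇ …` in
place of the cylinders along the geodesic. The frequencies `2 i - d` with `i < d / 4` are large,
and integration by parts applies. In the other terms the amplitude is replaced by its mean over
`B (d / 4)`, which costs its deviation from the mean; as `q^i ν(B (i + 1))` does not depend on
`i`, what remains is a geometric sum, with two boundary terms of large frequency. -/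
theorem exists_norm_sum_waveIntegral_le {q : ℕ} (hq : 2 ≤ q) (N : ℕ) :
    ∃ C : ℝ, 0 < C ∧ ∀ (Ω : Type u) [MeasurableSpace Ω] (ν : Measure Ω) [IsProbabilityMeasure ν]
      (A : ℕ → Ω → ℝ → ℂ) (M M' : ℝ) (d : ℕ) (B : ℕ → Set Ω),
      0 ≤ M' → (∀ i n, n ≤ i → i ≤ d → B i ⊆ B n) →
      (∀ i < d, ν.real (B (i + 1)) = ((q + 1) * q ^ i : ℝ)⁻¹) →
      AEStronglyMeasurable (Function.uncurry (A 0))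
        (ν.prod (volume.restrict (Ioc 0 (period q)))) →
      (∀ ω j, ∀ s ∈ Icc 0 (period q),
        HasDerivWithinAt (A j ω) (A (j + 1) ω s) (Icc 0 (period q)) s) →
      (∀ ω j, A j ω 0 = 0 ∧ A j ω (period q) = 0) →
      (∀ ω, ∀ j ≤ N + 1, ∀ s ∈ Icc 0 (period q), ‖A j ω s‖ ≤ M) →
      (∀ n ≤ d, ∀ ω ∈ B n, ∀ s ∈ Icc 0 (period q),
        ‖A 0 ω s - ⨍ ω' in B n, A 0 ω' s ∂ν‖ ≤ M' / (n + 1 : ℝ) ^ (N + 1)) →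
      ‖∫ ω, waveIntegral (Real.log q) (period q) (A 0) (fun s => (plancherelDensity q s : ℂ))
          (-d) ω ∂ν +
        ∑ i ∈ Finset.range d, (q : ℂ) ^ i * ∫ ω in B (i + 1),
          waveIntegral (Real.log q) (period q) (A 0) (numeratorDensity q) (2 * i - d) ω ∂ν‖ ≤
        C * (M + M') / (1 + d : ℝ) ^ N := by
  have hL : 0 < Real.log q := Real.log_pos (by exact_mod_cast (by omega : 1 < q))
  have hT := period_pos hq
  have hq0 : (0 : ℝ) < q := by exact_mod_cast (by omega : 0 < q)
  set T := period q
  obtain ⟨C₀, hC₀, h₀⟩ := exists_norm_integral_wave_le hL hT (N + 1) _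
    (contDiff_plancherelDensity hq)
  obtain ⟨C₁, hC₁, h₁⟩ := exists_norm_integral_wave_le hL hT (N + 1) _
    (contDiff_numeratorDensity hq)
  obtain ⟨C₂, hC₂, h₂⟩ := exists_norm_integral_wave_le hL hT (N + 1) _
    (contDiff_densityFactor hq)
  obtain ⟨D, hD⟩ := isCompact_Icc.exists_bound_of_continuousOn (s := Icc 0 T)
    (contDiff_numeratorDensity hq).continuous.continuousOn
  have hD0 : 0 ≤ D := (norm_nonneg _).trans (hD 0 ⟨le_rfl, hT.le⟩)
  set K := C₁ * 2 ^ (N + 1) + 4 ^ (N + 1) * D * T with hK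
  refine ⟨C₀ + K + (2 ^ (N + 1) + 1) * C₂ + 1, by positivity, ?_⟩
  intro Ω _ ν _ A M M' d B hM' hB hνB ha hA hA0 hM hreg
  have hc : ∀ ω, ContinuousOn (A 0 ω) (Icc 0 T) := fun ω s hs =>
    (hA ω 0 s hs).continuousWithinAt
  have hM00 : ∀ ω, ∀ s ∈ Icc 0 T, ‖A 0 ω s‖ ≤ M := fun ω => hM ω 0 (Nat.zero_le _)
  have hM0 : 0 ≤ M := by
    have := (nonempty_of_isProbabilityMeasure ν)
    exact (norm_nonneg _).trans (hM00 (Classical.arbitrary Ω) 0 ⟨le_rfl, hT.le⟩)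
  have b₀ := fun ω m => h₀ (fun j => A j ω) M (hA ω) (hA0 ω) (hM ω) m
  have b₁ := fun ω m => h₁ (fun j => A j ω) M (hA ω) (hA0 ω) (hM ω) m
  have b₂ := fun ω m => h₂ (fun j => A j ω) M (hA ω) (hA0 ω) (hM ω) m
  set P : ℝ := (1 + d : ℝ) ^ (N + 1) with hP
  have hP0 : 0 < P := by positivity
  set n := d / 4 with hn
  have hnd : n ≤ d := Nat.div_le_self d 4
  have hn4 : (1 + d : ℝ) ≤ 4 * (n + 1) := by exact_mod_cast (by omega : 1 + d ≤ 4 * (n + 1))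
  -- The low frequencies: `1 + |2 i - d| ≥ (1 + d) / 2` for `i ≤ d / 4`.
  have hlow : ∀ (C : ℝ), 0 ≤ C → ∀ i ≤ n,
      C * M / (1 + |((2 * i - d : ℤ) : ℝ)|) ^ (N + 1) ≤ C * 2 ^ (N + 1) * M / P := by
    intro C hC i hi
    have h : (1 + d : ℝ) ≤ 2 * (1 + |((2 * i - d : ℤ) : ℝ)|) := by
      have h₁ := neg_le_abs ((2 * i - d : ℤ) : ℝ)
      have h₂ : (4 * i : ℝ) ≤ d := by exact_mod_cast (by omega : 4 * i ≤ d)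
      push_cast at h₁ ⊢
      linarith
    rw [div_le_div_iff₀ (by positivity) hP0]
    have h' : P ≤ 2 ^ (N + 1) * (1 + |((2 * i - d : ℤ) : ℝ)|) ^ (N + 1) := by
      rw [hP, ← mul_pow]
      exact pow_le_pow_left₀ (by positivity) h _
    calc C * M * P ≤ C * M * (2 ^ (N + 1) * (1 + |((2 * i - d : ℤ) : ℝ)|) ^ (N + 1)) := by
          gcongr
      _ = _ := by ring
  have hcgd : Continuous (numeratorDensity q) := (contDiff_numeratorDensity hq).continuous
  have hcgf : Continuous (densityFactor q) := (contDiff_densityFactor hq).continuous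
  -- The mean of the amplitude over `B n` gives a telescoping sum.
  set F : ℕ → ℂ := fun i =>
    ⨍ ω in B n, waveIntegral (Real.log q) T (A 0) (densityFactor q) (2 * i - d) ω ∂ν with hF
  have hav : ∀ i : ℕ, ⨍ ω in B n,
      waveIntegral (Real.log q) T (A 0) (numeratorDensity q) (2 * i - d) ω ∂ν =
        F i - F (i + 1) := by
    intro i
    have hi : ∀ m, IntegrableOn (waveIntegral (Real.log q) T (A 0) (densityFactor q) m) (B n) ν :=
      fun m => (integrable_waveIntegral hT.le ha hM00 hcgf m).integrableOn
    simp only [hF, waveIntegral_numeratorDensity hq hT.le hc]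
    rw [setAverage_eq, setAverage_eq, setAverage_eq, integral_sub (hi _) (hi _), smul_sub]
    push_cast
    ring_nf
  have hFn : ‖F n‖ ≤ C₂ * 2 ^ (N + 1) * M / P :=
    norm_setAverage_le (by positivity) fun ω _ => (b₂ ω _).trans (hlow C₂ hC₂ n le_rfl)
  have hFd : ‖F d‖ ≤ C₂ * M / P := by
    refine norm_setAverage_le (by positivity) fun ω _ => (b₂ ω _).trans_eq ?_
    rw [hP]
    congr 3
    push_cast
    rw [show (2 * d - d : ℝ) = d by ring, abs_of_nonneg (Nat.cast_nonneg d)]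
  have hκ : ∀ i < d, (q : ℂ) ^ i * (ν.real (B (i + 1)) : ℂ) = (((q + 1 : ℝ)⁻¹ : ℝ) : ℂ) := by
    intro i hi
    have hqc : (q : ℂ) ≠ 0 := by exact_mod_cast hq0.ne'
    rw [hνB i hi]
    push_cast
    rw [mul_inv]
    field_simp
  have hκ' : ∀ i < d, ∀ b : ℝ, 0 ≤ b → ∀ z : ℂ, ‖z‖ ≤ b * ν.real (B (i + 1)) →
      ‖(q : ℂ) ^ i * z‖ ≤ b := by
    intro i hi b hb z hz
    rw [norm_mul, norm_pow, Complex.norm_natCast]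
    refine (mul_le_mul_of_nonneg_left hz (by positivity)).trans ?_
    rw [hνB i hi, mul_left_comm]
    refine mul_le_of_le_one_right hb ?_
    rw [← div_eq_mul_inv, div_le_one (by positivity)]
    have : (0 : ℝ) < q ^ i := by positivity
    nlinarith
  set X : ℕ → ℂ := fun i => (q : ℂ) ^ i * ∫ ω in B (i + 1),
    waveIntegral (Real.log q) T (A 0) (numeratorDensity q) (2 * i - d) ω ∂ν with hX
  set κ : ℂ := (((q + 1 : ℝ)⁻¹ : ℝ) : ℂ) with hκdef
  have hκ1 : ‖κ‖ ≤ 1 := by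
    rw [hκdef, Complex.norm_real, norm_inv, Real.norm_of_nonneg (by positivity)]
    exact inv_le_one_of_one_le₀ (by linarith)
  have hlowX : ∀ i < n, ‖X i‖ ≤ K * (M + M') / P := by
    intro i hi
    have h₁ : ‖X i‖ ≤ C₁ * 2 ^ (N + 1) * M / P := by
      refine hκ' i (by omega) _ (by positivity) _ ?_
      exact norm_setIntegral_le_of_norm_le_const (measure_lt_top ν _)
        fun ω _ => (b₁ ω _).trans (hlow C₁ hC₁ i hi.le)
    refine h₁.trans ?_
    gcongr
    · rw [hK]
      have : 0 ≤ 4 ^ (N + 1) * D * T := by positivity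
      linarith
    · linarith
  have hhighX : ∀ i, n ≤ i → i < d → ‖X i - κ * (F i - F (i + 1))‖ ≤ K * (M + M') / P := by
    intro i hi hid
    have hε : M' / (n + 1 : ℝ) ^ (N + 1) ≤ 4 ^ (N + 1) * M' / P := by
      rw [div_le_div_iff₀ (by positivity) hP0]
      have : P ≤ 4 ^ (N + 1) * (n + 1 : ℝ) ^ (N + 1) := by
        rw [hP, ← mul_pow]
        exact pow_le_pow_left₀ (by positivity) hn4 _
      calc M' * P ≤ M' * (4 ^ (N + 1) * (n + 1 : ℝ) ^ (N + 1)) := by gcongr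
        _ = _ := by ring
    have h₁ : ‖X i - κ * (F i - F (i + 1))‖ ≤ M' / (n + 1 : ℝ) ^ (N + 1) * D * T := by
      rw [← hκ i hid, hX, mul_assoc, ← mul_sub]
      refine hκ' i hid _ (by positivity) _ ?_
      refine norm_setIntegral_sub_le (integrable_waveIntegral hT.le ha hM00 hcgd _) fun ω hω => ?_
      rw [← hav]
      exact norm_waveIntegral_sub_setAverage_le hT.le ha hM00 hc hcgd hD _ (by positivity)
        (hreg n hnd ω (hB (i + 1) n (by omega) (by omega) hω))
    refine h₁.trans ?_
    calc M' / (n + 1 : ℝ) ^ (N + 1) * D * T ≤ 4 ^ (N + 1) * M' / P * D * T := by gcongr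
      _ = 4 ^ (N + 1) * D * T * M' / P := by ring
      _ ≤ K * (M + M') / P := by
        gcongr
        · rw [hK]
          have : 0 ≤ C₁ * 2 ^ (N + 1) := by positivity
          linarith
        · linarith
  have hsplit : ∑ i ∈ Finset.range d, X i = ∑ i ∈ Finset.range n, X i +
      ∑ i ∈ Finset.Ico n d, (X i - κ * (F i - F (i + 1))) + κ * (F n - F d) := by
    rw [Finset.sum_sub_distrib, ← Finset.mul_sum, sum_Ico_sub_succ F hnd,
      ← Finset.sum_range_add_sum_Ico X hnd]
    ring
  have hs₁ : ‖∑ i ∈ Finset.range n, X i‖ ≤ n * (K * (M + M') / P) := by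
    refine (norm_sum_le_of_le _ fun i hi => hlowX i (Finset.mem_range.1 hi)).trans_eq ?_
    simp
  have hs₂ : ‖∑ i ∈ Finset.Ico n d, (X i - κ * (F i - F (i + 1)))‖ ≤
      (d - n) * (K * (M + M') / P) := by
    refine (norm_sum_le_of_le _ fun i hi =>
      hhighX i (Finset.mem_Ico.1 hi).1 (Finset.mem_Ico.1 hi).2).trans_eq ?_
    simp [Nat.cast_sub hnd]
  have hs₃ : ‖κ * (F n - F d)‖ ≤ C₂ * 2 ^ (N + 1) * M / P + C₂ * M / P := by
    rw [norm_mul]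
    refine (mul_le_of_le_one_left (norm_nonneg _) hκ1).trans ?_
    exact (norm_sub_le _ _).trans (add_le_add hFn hFd)
  have hs₀ : ‖∫ ω, waveIntegral (Real.log q) T (A 0) (fun s => (plancherelDensity q s : ℂ))
      (-d) ω ∂ν‖ ≤ C₀ * M / P := by
    refine (norm_integral_le_of_norm_le_const (C := C₀ * M / P)
      (ae_of_all _ fun ω => (b₀ ω _).trans_eq ?_)).trans_eq (by simp)
    rw [hP]
    congr 3
    simp
  rw [hsplit]
  have hfin : C₀ * M / P + (n * (K * (M + M') / P) + (d - n) * (K * (M + M') / P) +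
      (C₂ * 2 ^ (N + 1) * M / P + C₂ * M / P)) ≤
      (C₀ + K + (2 ^ (N + 1) + 1) * C₂ + 1) * (M + M') / (1 + d : ℝ) ^ N := by
    have e : (1 + d : ℝ) ^ N = P / (1 + d) := by
      rw [hP, pow_succ]
      field_simp
    rw [e, div_div_eq_mul_div]
    have hd0 : (0 : ℝ) ≤ d := Nat.cast_nonneg d
    have : C₀ * M / P + (n * (K * (M + M') / P) + (d - n) * (K * (M + M') / P) +
      (C₂ * 2 ^ (N + 1) * M / P + C₂ * M / P)) =
      (C₀ * M + d * (K * (M + M')) + (2 ^ (N + 1) + 1) * C₂ * M) / P := by ring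
    rw [this]
    gcongr
    have hK0 : 0 ≤ K := by positivity
    have h₁ : C₀ * M ≤ C₀ * (M + M') * (1 + d) := by
      have : C₀ * M ≤ C₀ * (M + M') := by gcongr; linarith
      have : 0 ≤ C₀ * (M + M') * d := by positivity
      linarith
    have h₂ : (2 ^ (N + 1) + 1) * C₂ * M ≤ (2 ^ (N + 1) + 1) * C₂ * (M + M') * (1 + d) := by
      have : (2 ^ (N + 1) + 1) * C₂ * M ≤ (2 ^ (N + 1) + 1) * C₂ * (M + M') := by
        gcongr; linarith
      have : 0 ≤ (2 ^ (N + 1) + 1) * C₂ * (M + M') * d := by positivity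
      linarith
    have h₃ : 0 ≤ K * (M + M') := by positivity
    have h₄ : 0 ≤ (M + M') * (1 + d) := by positivity
    linarith
  refine (norm_add_le _ _).trans (le_trans ?_ hfin)
  refine add_le_add hs₀ ((norm_add_le _ _).trans (add_le_add ?_ hs₃))
  exact (norm_add_le _ _).trans (add_le_add hs₁ hs₂)

end Averages

/-! ### The kernel -/

section Kernel

variable {V : Type u} {G : SimpleGraph V}

theorem fourierIntegral_mul_const (q : ℕ) (o x y : V) (f : Boundary G → ℝ → ℂ) (c : ℂ) :
    fourierIntegral G q o x y (fun ω s => f ω s * c) = fourierIntegral G q o x y f * c := by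
  rw [fourierIntegral, fourierIntegral, ← integral_mul_const]
  congr 1 with ω
  rw [← intervalIntegral.integral_mul_const]
  congr 1 with s
  ring

/-- With `w = q^{2is}`, the identity `(q w)^j = 1 + ∑_{i < j} (q w)^i (q w - 1)` turns the
dependence on `j` into a sum over the cylinders that contain the boundary point; the factor
`q w - 1` is absorbed by the Plancherel density. -/
theorem cpow_mul_plancherelDensity_eq {q : ℕ} (hq : 2 ≤ q) {d j : ℕ} (hj : j ≤ d) (s : ℝ) (z : ℂ) :
    (q : ℂ) ^ ((1 / 2 + Complex.I * (s : ℂ)) * ((2 * (j : ℤ) - d : ℤ) : ℂ)) * z *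
        (plancherelDensity q s : ℂ) =
      (((q : ℝ) ^ (-(d : ℝ) / 2) : ℝ) : ℂ) *
        (wave (Real.log q) (-d) s * (z * plancherelDensity q s) +
          ∑ i ∈ Finset.range d, if i + 1 ≤ j then
            (q : ℂ) ^ i * (wave (Real.log q) (2 * i - d) s * (z * numeratorDensity q s)) else 0) := by
  have hq0 : (0 : ℝ) < q := by exact_mod_cast (by omega : 0 < q)
  set W := wave (Real.log q) 2 s with hW
  have hnum : numeratorDensity q s = (q * W - 1) * plancherelDensity q s := by
    rw [plancherelDensity_eq hq, mul_div_cancel₀]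
    exact natCast_mul_wave_sub_one_ne_zero hq _ _ _
  have hwave : ∀ i : ℕ, wave (Real.log q) (2 * i - d) s = W ^ i * wave (Real.log q) (-d) s := by
    intro i
    rw [sub_eq_add_neg, wave_add, hW, wave_eq_zpow _ (2 * i), wave_eq_zpow _ 2, zpow_mul]
    norm_cast
  have hpow : (q : ℂ) ^ ((1 / 2 + Complex.I * (s : ℂ)) * ((2 * (j : ℤ) - d : ℤ) : ℂ)) =
      (((q : ℝ) ^ (-(d : ℝ) / 2) : ℝ) : ℂ) * (q * W) ^ j * wave (Real.log q) (-d) s := by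
    have h := natCast_cpow_add_mul_I hq (-(d : ℝ) / 2 + j) s (2 * j - d)
    rw [Real.rpow_add hq0, Real.rpow_natCast, hwave] at h
    rw [mul_pow]
    push_cast at h ⊢
    calc _ = (q : ℂ) ^ (-(d : ℂ) / 2 + j + Complex.I * ((2 * j - d) * s)) := by
          congr 1
          ring
      _ = _ := by
          rw [h]
          ring
  have hsum : ∑ i ∈ Finset.range d, (if i + 1 ≤ j then
      (q : ℂ) ^ i * (wave (Real.log q) (2 * i - d) s * (z * numeratorDensity q s)) else 0) =
      ((q * W) ^ j - 1) * (wave (Real.log q) (-d) s * (z * plancherelDensity q s)) := by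
    have hf : (Finset.range d).filter (fun i => i + 1 ≤ j) = Finset.range j := by
      ext i
      simp only [Finset.mem_filter, Finset.mem_range]
      omega
    rw [← Finset.sum_filter, hf, ← geom_sum_mul, Finset.sum_mul, Finset.sum_mul]
    refine Finset.sum_congr rfl fun i _ => ?_
    rw [hwave, hnum, mul_pow]
    ring
  rw [hpow, hsum]
  ring

/-- The integral defining the kernel as a sum over the cylinders along the geodesic from `x` to
`y`, with one frequency for each cylinder. -/
theorem fourierIntegral_eq [G.LocallyFinite] (hG : G.IsTree) {q : ℕ} (hq : 2 ≤ q)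
    (hreg : G.IsRegularOfDegree (q + 1)) (o : V) {x y : V} {v : ℕ → V} (hv0 : v 0 = x)
    (hvd : v (G.dist x y) = y) (hv : ∀ i ≤ G.dist x y, G.dist x (v i) = i)
    (hadj : ∀ i < G.dist x y, G.Adj (v i) (v (i + 1))) {f : Boundary G → ℝ → ℂ} {M : ℝ}
    (hf : AEStronglyMeasurable (Function.uncurry f)
      ((boundaryMeasure G x).prod (volume.restrict (Ioc 0 (period q)))))
    (hc : ∀ ω, ContinuousOn (f ω) (Icc 0 (period q)))
    (hM : ∀ ω, ∀ s ∈ Icc 0 (period q), ‖f ω s‖ ≤ M) :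
    fourierIntegral G q o x y f = (((q : ℝ) ^ (-(G.dist x y : ℝ) / 2) : ℝ) : ℂ) *
      (∫ ω, waveIntegral (Real.log q) (period q) f (fun s => (plancherelDensity q s : ℂ))
          (-G.dist x y) ω ∂boundaryMeasure G x +
        ∑ i ∈ Finset.range (G.dist x y), (q : ℂ) ^ i * ∫ ω in cylinder G x (v (i + 1)),
          waveIntegral (Real.log q) (period q) f (numeratorDensity q) (2 * i - G.dist x y) ω
            ∂boundaryMeasure G x) := by
  have := isProbabilityMeasure_boundaryMeasure hG (by omega : 1 ≤ q) hreg x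
  have hT := (period_pos hq).le
  have hcp := (contDiff_plancherelDensity hq).continuous
  have hcn := (contDiff_numeratorDensity hq).continuous
  have hint : ∀ (g : ℝ → ℂ), Continuous g → ∀ m ω,
      IntervalIntegrable (fun s => wave (Real.log q) m s * (f ω s * g s)) volume 0 (period q) :=
    fun g hg m ω => ((contDiff_wave _ m).continuous.continuousOn.mul
      ((hc ω).mul hg.continuousOn)).intervalIntegrable_of_Icc hT
  set d := G.dist x y with hd
  have hinner : ∀ ω, (∫ s in (0 : ℝ)..period q,
      (q : ℂ) ^ ((1 / 2 + Complex.I * (s : ℂ)) * ((height G o ω y - height G o ω x : ℤ) : ℂ)) *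
        f ω s * (plancherelDensity q s : ℂ)) = (((q : ℝ) ^ (-(d : ℝ) / 2) : ℝ) : ℂ) *
      (waveIntegral (Real.log q) (period q) f (fun s => (plancherelDensity q s : ℂ)) (-d) ω +
        ∑ i ∈ Finset.range d, (cylinder G x (v (i + 1))).indicator (fun ω => (q : ℂ) ^ i *
          waveIntegral (Real.log q) (period q) f (numeratorDensity q) (2 * i - d) ω) ω) := by
    intro ω
    obtain ⟨j, hj, hh, hmem⟩ := exists_confluence hG o hv0 hvd hv hadj ω
    rw [hh]
    simp only [cpow_mul_plancherelDensity_eq hq hj]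
    have hint' : ∀ i ∈ Finset.range d, IntervalIntegrable (fun s => if i + 1 ≤ j then
        (q : ℂ) ^ i * (wave (Real.log q) (2 * i - d) s * (f ω s * numeratorDensity q s)) else 0)
        volume 0 (period q) := by
      intro i _
      split_ifs
      · exact (hint _ hcn _ ω).const_mul _
      · exact intervalIntegrable_const
    have hsum : IntervalIntegrable (fun s => ∑ i ∈ Finset.range d, if i + 1 ≤ j then
        (q : ℂ) ^ i * (wave (Real.log q) (2 * i - d) s * (f ω s * numeratorDensity q s)) else 0)
        volume 0 (period q) := by
      have := IntervalIntegrable.sum _ hint'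
      simpa only [Finset.sum_fn] using this
    rw [intervalIntegral.integral_const_mul, intervalIntegral.integral_add (hint _ hcp _ ω) hsum,
      intervalIntegral.integral_finsetSum hint']
    congr 2
    refine Finset.sum_congr rfl fun i hi => ?_
    rw [Finset.mem_range] at hi
    by_cases h : i + 1 ≤ j
    · rw [indicator_of_mem ((hmem (i + 1) hi).2 h)]
      simp only [if_pos h]
      rw [intervalIntegral.integral_const_mul]
      rfl
    · rw [indicator_of_notMem fun h' => h ((hmem (i + 1) hi).1 h')]
      simp only [if_neg h]
      exact intervalIntegral.integral_zero
  have hI := fun (g : ℝ → ℂ) (hg : Continuous g) m =>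
    integrable_waveIntegral (L := Real.log q) hT hf hM hg m
  have hIi : ∀ i ∈ Finset.range d, Integrable ((cylinder G x (v (i + 1))).indicator fun ω =>
      (q : ℂ) ^ i * waveIntegral (Real.log q) (period q) f (numeratorDensity q) (2 * i - d) ω)
      (boundaryMeasure G x) := fun i _ =>
    ((hI _ hcn _).const_mul _).indicator (measurableSet_cylinder _ _)
  rw [fourierIntegral]
  simp only [hinner]
  rw [integral_const_mul, integral_add (hI _ hcp _) (integrable_finsetSum _ hIi),
    integral_finsetSum _ hIi]
  congr 2
  refine Finset.sum_congr rfl fun i _ => ?_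
  rw [integral_indicator (measurableSet_cylinder _ _), integral_const_mul]

/-! ### The norms of double symbols -/

theorem norm_le_of_fullSupNorm_le {q : ℕ} {a : DoubleFunction G} {M : ℝ} (hM : 0 ≤ M)
    (h : fullSupNorm q a ≤ ENNReal.ofReal M) (x y : V) (ω : Boundary G) {s : ℝ}
    (hs : s ∈ Icc 0 (period q)) : ‖a x y ω s‖ ≤ M := by
  have h₁ : ‖a x y ω s‖ₑ ≤ fullSupNorm q a :=
    (le_iSup₂_of_le ω s
      (le_iSup (fun _ : s ∈ Icc 0 (period q) => ‖a x y ω s‖ₑ) hs)).trans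
      (le_iSup₂ (f := fun x y => supNorm q (a x y)) x y)
  rw [← ofReal_norm] at h₁
  exact (ENNReal.ofReal_le_ofReal_iff hM).1 (h₁.trans h)

theorem norm_deviation_le_of_omegaNorm_le {q l : ℕ} {a : DoubleFunction G} {M : ℝ} (hM : 0 ≤ M)
    (h : omegaNorm q l a ≤ ENNReal.ofReal M) (x y : V) (n : ℕ) (ω : Boundary G) {s : ℝ}
    (hs : s ∈ Icc 0 (period q)) : ‖deviation n a x y ω s‖ ≤ M / (n + 1 : ℝ) ^ l := by
  have h₀ : ‖deviation n a x y ω s‖ₑ ≤ supNorm q (deviation n a x y) :=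
    le_iSup₂_of_le ω s
      (le_iSup (fun _ : s ∈ Icc 0 (period q) => ‖deviation n a x y ω s‖ₑ) hs)
  have h₁ : ((n : ℝ≥0∞) + 1) ^ l * ‖deviation n a x y ω s‖ₑ ≤ omegaNorm q l a :=
    (mul_le_mul_right h₀ _).trans (le_iSup_of_le x (le_iSup₂
      (f := fun y (n : ℕ) => ((n : ℝ≥0∞) + 1) ^ l * supNorm q (deviation n a x y)) y n))
  have e : ((n : ℝ≥0∞) + 1) ^ l = ENNReal.ofReal ((n + 1 : ℝ) ^ l) := by
    rw [ENNReal.ofReal_pow (by positivity), ENNReal.ofReal_add (by positivity) zero_le_one]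
    simp
  rw [e, ← ofReal_norm, ← ENNReal.ofReal_mul (by positivity)] at h₁
  rw [le_div_iff₀ (by positivity), mul_comm]
  exact (ENNReal.ofReal_le_ofReal_iff hM).1 (h₁.trans h)

theorem IsDoubleSymbol.omegaNorm_lt_top {q : ℕ} {a : DoubleFunction G} (ha : IsDoubleSymbol q a)
    (l : ℕ) : omegaNorm q l a < ⊤ := by
  obtain ⟨C, hC⟩ := ha.regular l
  refine lt_of_le_of_lt (b := ENNReal.ofReal C) ?_ ENNReal.ofReal_lt_top
  refine iSup₂_le fun x y => iSup_le fun n => ?_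
  have e : ((n : ℝ≥0∞) + 1) ^ l = ENNReal.ofReal ((1 + n : ℝ) ^ l) := by
    rw [ENNReal.ofReal_pow (by positivity), ENNReal.ofReal_add zero_le_one (by positivity),
      add_comm]
    simp
  rw [supNorm]
  simp only [ENNReal.mul_iSup]
  refine iSup₂_le fun ω s => iSup_le fun hs => ?_
  rw [e, ← ofReal_norm, ← ENNReal.ofReal_mul (by positivity)]
  refine ENNReal.ofReal_le_ofReal ?_
  have := hC n x y ω s hs
  rwa [le_div_iff₀ (by positivity), mul_comm] at this

theorem IsDoubleSymbol.hasDerivWithinAt {q : ℕ} (hq : 2 ≤ q) {a : DoubleFunction G}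
    (ha : IsDoubleSymbol q a) (x y : V) (ω : Boundary G) (k : ℕ) {s : ℝ}
    (hs : s ∈ Icc 0 (period q)) :
    HasDerivWithinAt (sDeriv q k a x y ω) (sDeriv q (k + 1) a x y ω s) (Icc 0 (period q)) s := by
  have h := (ha.smooth x y ω).differentiableOn_iteratedDerivWithin (m := k)
    (by exact_mod_cast ENat.natCast_lt_top k) (uniqueDiffOn_Icc (period_pos hq)) s hs
  have := h.hasDerivWithinAt
  rwa [← iteratedDerivWithin_succ] at this

theorem IsDoubleSymbol.aestronglyMeasurable {q : ℕ} {a : DoubleFunction G}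
    (ha : IsDoubleSymbol q a) (x y : V) (ν : Measure (Boundary G)) [SFinite ν] :
    AEStronglyMeasurable (Function.uncurry (a x y))
      (ν.prod (volume.restrict (Ioc 0 (period q)))) := by
  have hc : ContinuousOn (Function.uncurry (a x y)) (univ ×ˢ Icc 0 (period q)) := by
    have := ha.continuous 0 x y
    simp only [sDeriv, iteratedDerivWithin_zero] at this
    exact this
  have h := (hc.mono (prod_mono_right Ioc_subset_Icc_self)).aestronglyMeasurable
    (μ := ν.prod volume) (MeasurableSet.univ.prod measurableSet_Ioc)
  rwa [← Measure.prod_restrict, Measure.restrict_univ] at h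

end Kernel

end HomTree

theorem mainTheorem2 (q : ℕ) (hq : 2 ≤ q) (N : ℕ) :
    ∃ C : ℝ, 0 < C ∧
      ∀ (V : Type u) (G : SimpleGraph V) [G.LocallyFinite],
        G.IsTree → G.IsRegularOfDegree (q + 1) →
        ∀ (o : V) (a : HomTree.DoubleFunction G), HomTree.IsDoubleSymbol q a →
          (∀ (f : V →₀ ℂ) (x : V),
            HomTree.OP q o a f x = ∑ y ∈ f.support, HomTree.kernel q o a x y * f y) ∧
          (∀ x y : V,
            ‖HomTree.kernel q o a x y‖ₑ ≤
              ENNReal.ofReal C *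
                (HomTree.omegaNorm q (N + 1) a +
                  ∑ k ∈ Finset.range (N + 2), HomTree.fullSupNorm q (HomTree.sDeriv q k a)) *
                ENNReal.ofReal
                  ((q : ℝ) ^ (-(G.dist x y : ℝ) / 2) / (1 + (G.dist x y : ℝ)) ^ N)) ∧
          ((∀ k ≤ N + 1, HomTree.fullSupNorm q (HomTree.sDeriv q k a) < ⊤) →
            HomTree.omegaNorm q (N + 1) a +
              ∑ k ∈ Finset.range (N + 2), HomTree.fullSupNorm q (HomTree.sDeriv q k a) < ⊤) := by
  have hq0 : (0 : ℝ) < q := by exact_mod_cast (by omega : 0 < q)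
  obtain ⟨C, hC, hbound⟩ := HomTree.exists_norm_sum_waveIntegral_le.{u} hq N
  refine ⟨C, hC, fun V G _ hG hreg o a ha => ⟨fun f x => ?_, fun x y => ?_, fun h => ?_⟩⟩
  · exact Finset.sum_congr rfl fun y _ => HomTree.fourierIntegral_mul_const q o x y _ _
  · have hdecay : (0 : ℝ) < (q : ℝ) ^ (-(G.dist x y : ℝ) / 2) / (1 + (G.dist x y : ℝ)) ^ N := by
      positivity
    set S := ∑ k ∈ Finset.range (N + 2), HomTree.fullSupNorm q (HomTree.sDeriv q k a) with hS
    -- If one of the norms is infinite, then so is the right-hand side.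
    rcases eq_or_ne S ⊤ with hSt | hSt
    · rw [hSt, add_top, ENNReal.mul_top (by simpa using hC), ENNReal.top_mul (by simpa using hdecay)]
      exact le_top
    have hO := (ha.omegaNorm_lt_top (N + 1)).ne
    set M' := (HomTree.omegaNorm q (N + 1) a).toReal with hM'
    set M := S.toReal with hM
    have hM'0 : 0 ≤ M' := ENNReal.toReal_nonneg
    have hM0 : 0 ≤ M := ENNReal.toReal_nonneg
    have eO : HomTree.omegaNorm q (N + 1) a = ENNReal.ofReal M' := (ENNReal.ofReal_toReal hO).symm
    have eS : S = ENNReal.ofReal M := (ENNReal.ofReal_toReal hSt).symm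
    obtain ⟨v, hv0, hvd, hv, hadj⟩ := HomTree.exists_geodesic hG.connected x y
    have := HomTree.isProbabilityMeasure_boundaryMeasure hG (by omega : 1 ≤ q) hreg x
    have hmeas := ha.aestronglyMeasurable x y (HomTree.boundaryMeasure G x)
    have hzero : HomTree.sDeriv q 0 a = a := by
      funext x y ω s
      simp [HomTree.sDeriv]
    have hbd : ∀ ω, ∀ k ≤ N + 1, ∀ s ∈ Icc 0 (HomTree.period q),
        ‖HomTree.sDeriv q k a x y ω s‖ ≤ M := by
      intro ω k hk s hs
      refine HomTree.norm_le_of_fullSupNorm_le hM0 ?_ x y ω hs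
      rw [← eS, hS]
      exact Finset.single_le_sum (f := fun k => HomTree.fullSupNorm q (HomTree.sDeriv q k a))
        (fun _ _ => zero_le) (Finset.mem_range.2 (by omega))
    have hform := HomTree.fourierIntegral_eq hG hq hreg o hv0 hvd (fun i hi => (hv i hi).1) hadj
      hmeas (fun ω => (ha.smooth x y ω).continuousOn)
      (fun ω s hs => by simpa [hzero] using hbd ω 0 (Nat.zero_le _) s hs)
    have hB := hbound (HomTree.Boundary G) (HomTree.boundaryMeasure G x)
      (fun k => HomTree.sDeriv q k a x y) M M' (G.dist x y) (fun i => HomTree.cylinder G x (v i))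
      hM'0 ?_ ?_ (by rwa [hzero]) (fun ω k s hs => ha.hasDerivWithinAt hq x y ω k hs)
      (fun ω k => ha.vanish k x y ω) hbd ?_
    · rw [hzero] at hB
      rw [HomTree.kernel, hform, ← ofReal_norm, eO, eS, ← ENNReal.ofReal_add hM'0 hM0,
        ← ENNReal.ofReal_mul hC.le, ← ENNReal.ofReal_mul (by positivity)]
      refine ENNReal.ofReal_le_ofReal ?_
      rw [norm_mul, Complex.norm_real, Real.norm_of_nonneg (by positivity)]
      refine (mul_le_mul_of_nonneg_left hB (by positivity)).trans_eq ?_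
      rw [add_comm M' M]
      ring
    · intro i n hni hi ω hω
      obtain ⟨j, -, -, hj⟩ := HomTree.exists_confluence hG o hv0 hvd (fun i hi => (hv i hi).1)
        hadj ω
      exact (hj n (by omega)).2 (hni.trans ((hj i hi).1 hω))
    · intro i hi
      exact HomTree.boundaryMeasure_cylinder hG (by omega) hreg (hv (i + 1) hi).1
    · intro n hn ω hω s hs
      have h := HomTree.norm_deviation_le_of_omegaNorm_le hM'0 eO.le x y n ω hs
      have hd := (hv n hn).1
      have hcyl := HomTree.cylinderAt_eq hG hω
      rw [hd] at hcyl
      rw [HomTree.deviation, HomTree.averaging, hcyl] at h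
      simpa only [hzero] using h
  · refine ENNReal.add_lt_top.2 ⟨ha.omegaNorm_lt_top _, ENNReal.sum_lt_top.2 fun k hk => ?_⟩
    exact h k (by have := Finset.mem_range.1 hk; omega)
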